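/- Theorem (Riesz vs Riemann–Liouville). Let $m\ge 1$ be an integer, $0\le m-1<\alpha<m$, and let $\phi:\mathbb R\to\mathbb R$ be a symmetric function, $\phi(x)=\phi(|x|)$, that is $m$ times continuously differentiable on $(0,\infty)$. Suppose that for some $\sigma=\Re(s)\in(0,1)$ and all $j=0,\dots,m-1$ $$\lim_{r\to0^+}\phi^{(j)}(r)\,r^{\sigma-\alpha+j}=0,\qquad \lim_{r\to+\infty}\phi^{(j)}(r)\,r^{\sigma-\alpha+j}=0,\qquad \phi^{(j)}(0^+)=0 .$$ Notation. The Riemann–Liouville fractional derivative is $\mathcal D^{\alpha}_{RL}\phi(t)=\frac{d^m}{dt^m}J^{m-\alpha}\phi(t)$, $t>0$, where $J^{\mu}\phi(t)=\frac1{\Gamma(\mu)}\int_0^t(t-\tau)^{\mu-1}\phi(\tau)\,d\tau$. The Riesz fractional derivative $\mathcal D_x^\alpha=-(-d^2/dx^2)^{\alpha/2}$ (with symbol $-|\kappa|^\alpha$) is, for $0<\alpha<2$, $$\mathcal D_x^\alpha f(x)=\frac{\Gamma(1+\alpha)}{\pi}\sin\frac{\pi\alpha}{2}\int_0^\infty\frac{f(x+z)-2f(x)+f(x-z)}{z^{1+\alpha}}\,dz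 ,$$ and for $\alpha=2l+\beta$ with an integer $l\ge1$ and $0<\beta<2$ it is $\mathcal D_x^\alpha f=\mathcal D_x^\beta\big[(-d^2/dx^2)^l f\big]$. The kernel is $$\mathcal E(u)=\frac2\pi\,\frac{\sin(\pi\alpha/2)}{1-u^2}-\cos\Big(\frac{\pi\alpha}2\Big)\,u\,\delta(u-1),\qquad u>0 .$$ Conclusion. The function $J^{m-\alpha}\phi$ is $m$ times continuously differentiable on $(0,\infty)$; for every $x\ne0$ the integral defining $\mathcal D_x^\alpha\phi(x)$ converges absolutely, and $$\mathcal D_x^\alpha\phi(|x|)=\int_0^\infty\big\{\mathcal D^{\alpha}_{RL}\phi(\xi)\big\}\,\mathcal E(|x|/\xi)\,\frac{d\xi}{\xi},$$ where the right-hand side means $$\frac2\pi\sin\Big(\frac{\pi\alpha}2\Big)\ \mathrm{p.v.}\!\int_0^\infty\frac{\mathcal D^{\alpha}_{RL}\phi(\xi)}{1-(|x|/\xi)^2}\,\frac{d\xi}{\xi}\;-\;\cos\Big(\frac{\pi\alpha}2\Big)\,\mathcal D^{\alpha}_{RL}\phi(|x|),$$ the integral being taken as a Cauchy principal value at $\xi=|x|$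 and as an improper integral at $0$ and $\infty$ (part of the claim is that it converges in this sense). -/

import Mathlib

open Set Filter Topology MeasureTheory

noncomputable section

/-- Riemann--Liouville fractional integral
`J^μ f (t) = (1/Γ(μ)) ∫_0^t (t - τ)^(μ - 1) f(τ) dτ`, for `t > 0`. -/
def rlIntegral (μ : ℝ) (f : ℝ → ℝ) (t : ℝ) : ℝ :=
  (1 / Real.Gamma μ) * ∫ τ in (0 : ℝ)..t, (t - τ) ^ (μ - 1) * f τ

/-- Riemann--Liouville fractional derivative of order `α`, `m - 1 < α < m`:
`(d/dt)^m J^(m - α) f (t)`, for `t > 0`. -/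
def rlDeriv (m : ℕ) (α : ℝ) (f : ℝ → ℝ) (t : ℝ) : ℝ :=
  iteratedDeriv m (rlIntegral ((m : ℝ) - α) f) t

/-- Integrand of the regularised integral form of the Riesz derivative of order `β ∈ (0, 2)`. -/
def rieszIntegrand (β : ℝ) (f : ℝ → ℝ) (x z : ℝ) : ℝ :=
  (f (x + z) - 2 * f x + f (x - z)) / z ^ (1 + β)

/-- Riesz derivative of order `β ∈ (0, 2)` (symbol `-|κ|^β`) in regularised integral form. -/
def rieszDerivBase (β : ℝ) (f : ℝ → ℝ) (x : ℝ) : ℝ :=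
  Real.Gamma (1 + β) / Real.pi * Real.sin (Real.pi * β / 2) *
    ∫ z in Ioi (0 : ℝ), rieszIntegrand β f x z

/-- The integer `l` with `2 l ≤ α < 2 l + 2`. -/
def rieszShift (α : ℝ) : ℕ := ⌊α / 2⌋₊

/-- The function `(-d²/dx²)^l f`, where `2 l ≤ α < 2 l + 2`; it is `f` itself if `0 < α < 2`. -/
def rieszInner (α : ℝ) (f : ℝ → ℝ) (x : ℝ) : ℝ :=
  (-1) ^ rieszShift α * iteratedDeriv (2 * rieszShift α) f x

/-- Riesz derivative `-(-d²/dx²)^(α/2)` (symbol `-|κ|^α`) of order `α > 0`, `α ∉ 2ℕ`.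
For `0 < α < 2` it is the regularised integral `rieszDerivBase α`. For larger `α = 2 l + β` with
`0 < β < 2` one has `-|κ|^α = -|κ|^β (κ²)^l`, so it is the derivative of order `β` of
`(-d²/dx²)^l f`. -/
def rieszDeriv (α : ℝ) (f : ℝ → ℝ) (x : ℝ) : ℝ :=
  rieszDerivBase (α - 2 * rieszShift α) (rieszInner α f) x

/-- The integral that defines `rieszDeriv α f x` converges absolutely. -/
def RieszConvergent (α : ℝ) (f : ℝ → ℝ) (x : ℝ) : Prop :=
  IntegrableOn (rieszIntegrand (α - 2 * rieszShift α) (rieszInner α f) x) (Ioi 0)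

/-- `F` has, over `(0, ∞)`, the integral `I`: improper at `0` and at `∞` and in the sense of
Cauchy's principal value at the point `r > 0`. -/
def HasPVIntegral (F : ℝ → ℝ) (r I : ℝ) : Prop :=
  LocallyIntegrableOn F (Ioi 0 \ {r}) ∧
  Tendsto (fun p : ℝ × ℝ × ℝ => (∫ ξ in p.1..(r - p.2.1), F ξ) + ∫ ξ in (r + p.2.1)..p.2.2, F ξ)
    (𝓝[>] 0 ×ˢ (𝓝[>] 0 ×ˢ atTop)) (𝓝 I)

/-- The part `(2/π) sin(πα/2) / (1 - u²)` of the kernel `𝓔` that is a function. -/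
def kernelRegular (α u : ℝ) : ℝ :=
  2 / Real.pi * (Real.sin (Real.pi * α / 2) / (1 - u ^ 2))

/-- The pairing `∫_0^∞ g(ξ) (-cos(πα/2) u δ(u - 1))|_{u = r/ξ} dξ/ξ` of `g` with the Dirac part of
the kernel `𝓔`, written in the variable `u = r / ξ`, for which `dξ/ξ` becomes `du/u`. -/
def kernelDiracPart (α : ℝ) (g : ℝ → ℝ) (r : ℝ) : ℝ :=
  -Real.cos (Real.pi * α / 2) * ∫ u, g (r / u) * u / u ∂(Measure.dirac (1 : ℝ))

/-- `∫_0^∞ g(ξ) 𝓔(r/ξ) dξ/ξ = I`, where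
`𝓔(u) = (2/π) sin(πα/2) / (1 - u²) - cos(πα/2) u δ(u - 1)`: the Mellin convolution of `g`
with `𝓔` exists at `r` and has the value `I`. -/
def HasMellinConvolution (α : ℝ) (g : ℝ → ℝ) (r I : ℝ) : Prop :=
  ∃ P : ℝ, HasPVIntegral (fun ξ => g ξ * kernelRegular α (r / ξ) / ξ) r P ∧
    I = P + kernelDiracPart α g r

end

/-! Write `α = n + a` with `n = m - 1` and `0 < a < 1`, and let `h` be the `n`-th derivative of `φ`
on `(0, ∞)`, extended by zero to the left. Put `G = u₊^(-a) * h`. The vanishing of the derivatives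
of `φ` at `0+` lets `n` derivatives of `J^(1-a) φ` fall on `φ`, so the Riemann–Liouville derivative
is `G' / Γ(1-a)`. Moreover `G' = a M₋`, where `M₋(r) = ∫ (h r - h (r - z)) z^(-1-a) dz` is the
Marchaud integral (`hasDerivAt_truncPowConv`).

The regular part of the kernel is `1/(ξ - r) + 1/(ξ + r)` up to a constant. Integration by parts
turns the principal value of `∫ G'(ξ)/(ξ - r)` into `∫ (G(r+η) + G(r-η) - 2 G(r)) / η² dη`, and `∫
G'(ξ)/(ξ + r)` into `∫ G(ξ)/(ξ + r)² dξ`. By Fubini the first needs only the `η`-integral of the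
second difference of `u₊^(-a)`, which is homogeneous of degree `-1 - a` in the base point; its
values at `1` and `-1` are `-aπ cot πa` and `aπ / sin πa`. With `M₊` the forward analogue of `M₋`
and `K = ∫ h τ (τ + r)^(-1-a) dτ`, the two integrals are `aπ cot(πa) M₋ + aπ/sin(πa) M₊` and
`aπ/sin(πa) K` (`integrableOn_and_integral_second_diff`,
`integrableOn_and_integral_truncPowConv_div_sq`).

The Riesz derivative of an even function is made of the same quantities. Its singular integral is
`±(M₊ - M₋ + K)` if `n` is even (order `a`) and `±(M₊ + M₋ + K)/(1 + a)` if `n` is odd (order `1 +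
a`). The coefficients of `M₊` and `K` agree by the reflection formula for `Γ`. The Dirac part of the
kernel corrects only the coefficient of `M₋`, and a half-angle identity shows that it does so
exactly. -/

/-- The truncated power `u₊^(-a)`. -/
noncomputable def truncPow (a u : ℝ) : ℝ := if 0 < u then u ^ (-a) else 0

/-- The symmetric second difference of the truncated power `u₊^(-a)`. -/
noncomputable def truncPowDiff (a s η : ℝ) : ℝ :=
  truncPow a (s + η) + truncPow a (s - η) - 2 * truncPow a s

theorem truncPow_of_pos (a : ℝ) {u : ℝ} (hu : 0 < u) : truncPow a u = u ^ (-a) := if_pos hu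

theorem truncPow_of_nonpos (a : ℝ) {u : ℝ} (hu : u ≤ 0) : truncPow a u = 0 := if_neg hu.not_gt

theorem truncPow_nonneg (a u : ℝ) : 0 ≤ truncPow a u := by
  unfold truncPow; split_ifs with h
  · exact (Real.rpow_pos_of_pos h _).le
  · exact le_rfl

@[fun_prop]
theorem measurable_truncPow (a : ℝ) : Measurable (truncPow a) :=
  Measurable.ite measurableSet_Ioi (by fun_prop) (by fun_prop)

theorem truncPow_mul (a : ℝ) {l : ℝ} (hl : 0 < l) (u : ℝ) :
    truncPow a (l * u) = l ^ (-a) * truncPow a u := by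
  unfold truncPow
  by_cases hu : 0 < u
  · rw [if_pos hu, if_pos (mul_pos hl hu), Real.mul_rpow hl.le hu.le]
  · rw [if_neg hu, if_neg (by simpa [hl] using hu), mul_zero]

theorem truncPowDiff_mul (a : ℝ) {l : ℝ} (hl : 0 < l) (s η : ℝ) :
    truncPowDiff a (l * s) (l * η) = l ^ (-a) * truncPowDiff a s η := by
  unfold truncPowDiff
  rw [← mul_add, ← mul_sub, truncPow_mul a hl, truncPow_mul a hl, truncPow_mul a hl]; ring

/-! ### The two constants: Beta integral and cotangent series -/

theorem image_inv_one_add_Ioi : (fun u : ℝ => 1 / (1 + u)) '' Ioi 0 = Ioo 0 1 := by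
  ext t
  simp only [mem_image, mem_Ioi, mem_Ioo]
  constructor
  · rintro ⟨u, hu, rfl⟩
    exact ⟨by positivity, by rw [div_lt_one (by positivity)]; linarith⟩
  · rintro ⟨h0, h1⟩
    refine ⟨1 / t - 1, ?_, by field_simp; ring⟩
    rw [sub_pos, lt_div_iff₀ h0]; linarith

theorem hasDerivWithinAt_inv_one_add (x : ℝ) (hx : x ∈ Ioi (0 : ℝ)) :
    HasDerivWithinAt (fun u : ℝ => 1 / (1 + u)) (-(1 / (1 + x) ^ 2)) (Ioi 0) x := by
  have hx' : 1 + x ≠ 0 := by have := mem_Ioi.1 hx; positivity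
  have := (((hasDerivAt_id x).const_add 1).inv hx').hasDerivWithinAt (s := Ioi 0)
  simpa [Pi.inv_def, neg_div] using this

theorem injOn_inv_one_add : InjOn (fun u : ℝ => 1 / (1 + u)) (Ioi 0) := by
  intro x hx y hy h
  have := mem_Ioi.1 hx
  have := mem_Ioi.1 hy
  simp only [one_div, inv_inj, add_right_inj] at h
  exact h

theorem integral_Ioo_eq_integral_Ioi_inv_one_add (g : ℝ → ℝ) :
    ∫ t in Ioo 0 1, g t = ∫ u in Ioi 0, 1 / (1 + u) ^ 2 * g (1 / (1 + u)) := by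
  rw [← image_inv_one_add_Ioi, integral_image_eq_integral_abs_deriv_smul measurableSet_Ioi
    hasDerivWithinAt_inv_one_add injOn_inv_one_add]
  simp

theorem integrableOn_Ioo_iff_integrableOn_Ioi_inv_one_add (g : ℝ → ℝ) :
    IntegrableOn g (Ioo 0 1) ↔ IntegrableOn (fun u => 1 / (1 + u) ^ 2 * g (1 / (1 + u))) (Ioi 0) := by
  rw [← image_inv_one_add_Ioi, integrableOn_image_iff_integrableOn_abs_deriv_smul measurableSet_Ioi
    hasDerivWithinAt_inv_one_add injOn_inv_one_add]
  simp

theorem integral_rpow_mul_one_sub_rpow {x y : ℝ} (hx : 0 < x) (hy : 0 < y) :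
    ∫ t in Ioo (0 : ℝ) 1, t ^ (x - 1) * (1 - t) ^ (y - 1) =
      Real.Gamma x * Real.Gamma y / Real.Gamma (x + y) := by
  have h := ProbabilityTheory.beta_eq_betaIntegralReal x y hx hy
  rw [ProbabilityTheory.beta] at h
  rw [h, Complex.betaIntegral, intervalIntegral.integral_of_le zero_le_one,
    integral_Ioc_eq_integral_Ioo]
  rw [setIntegral_congr_fun (g := fun t : ℝ => ((t ^ (x - 1) * (1 - t) ^ (y - 1) : ℝ) : ℂ))
    measurableSet_Ioo, integral_complex_ofReal, Complex.ofReal_re]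
  intro t ht
  simp only
  rw [Complex.ofReal_mul, Complex.ofReal_cpow ht.1.le, Complex.ofReal_cpow (by linarith [ht.2])]
  push_cast; rfl

/-- The substitution `t = 1/(1+u)` turns this into the Beta integral `B(1 + a, 1 - a) = Γ(1+a)
Γ(1-a)`, which the reflection formula evaluates. -/
theorem integral_rpow_neg_div_one_add_sq {a : ℝ} (ha0 : 0 < a) (ha1 : a < 1) :
    ∫ u in Ioi (0 : ℝ), u ^ (-a) / (1 + u) ^ 2 = a * Real.pi / Real.sin (Real.pi * a) := by
  have h := integral_rpow_mul_one_sub_rpow (x := 1 + a) (y := 1 - a) (by linarith) (by linarith)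
  rw [integral_Ioo_eq_integral_Ioi_inv_one_add] at h
  have e : Real.Gamma (1 + a) * Real.Gamma (1 - a) / Real.Gamma (1 + a + (1 - a))
      = a * Real.pi / Real.sin (Real.pi * a) := by
    rw [show 1 + a + (1 - a) = 2 by ring, Real.Gamma_two, div_one, add_comm 1 a,
      Real.Gamma_add_one ha0.ne', mul_assoc, Real.Gamma_mul_Gamma_one_sub]; ring
  rw [← e, ← h]
  refine setIntegral_congr_fun measurableSet_Ioi fun u hu => ?_
  have hu : 0 < u := hu
  have h1 : 1 - 1 / (1 + u) = u * (1 / (1 + u)) := by field_simp; ring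
  rw [h1, Real.mul_rpow hu.le (by positivity), show 1 + a - 1 = a by ring,
    show 1 - a - 1 = -a by ring]
  have : (1 / (1 + u)) ^ a * (1 / (1 + u)) ^ (-a) = 1 := by
    rw [← Real.rpow_add (by positivity)]; simp
  rw [div_eq_mul_one_div]
  linear_combination (-(u ^ (-a) * (1 / (1 + u) ^ 2))) * this

theorem mul_pi_div_sin_pos {a : ℝ} (ha0 : 0 < a) (ha1 : a < 1) :
    0 < a * Real.pi / Real.sin (Real.pi * a) := by
  have : 0 < Real.sin (Real.pi * a) :=
    Real.sin_pos_of_pos_of_lt_pi (by positivity) (by nlinarith [Real.pi_pos])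
  positivity

theorem integrableOn_rpow_neg_div_one_add_sq {a : ℝ} (ha0 : 0 < a) (ha1 : a < 1) :
    IntegrableOn (fun u : ℝ => u ^ (-a) / (1 + u) ^ 2) (Ioi 0) := by
  -- The Bochner integral of a non-integrable function is `0`, so a nonzero value proves
  -- integrability.
  refine Integrable.of_integral_ne_zero ?_
  rw [integral_rpow_neg_div_one_add_sq ha0 ha1]
  exact (mul_pi_div_sin_pos ha0 ha1).ne'

/-- At the base point `-1` only the term `(η - 1)₊^(-a)` survives, and a shift by `1` leads to the
Beta integral. -/
theorem integral_truncPowDiff_neg_one {a : ℝ} (ha0 : 0 < a) (ha1 : a < 1) :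
    ∫ η in Ioi 0, truncPowDiff a (-1) η / η ^ 2 = a * Real.pi / Real.sin (Real.pi * a) := by
  rw [← integral_rpow_neg_div_one_add_sq ha0 ha1, ← integral_indicator measurableSet_Ioi,
    ← integral_indicator measurableSet_Ioi, ← integral_sub_right_eq_self ((Ioi (0 : ℝ)).indicator
      fun u : ℝ => u ^ (-a) / (1 + u) ^ 2) (1 : ℝ)]
  congr 1; ext η
  by_cases h1 : 1 < η
  · rw [indicator_of_mem (mem_Ioi.2 (by linarith)), indicator_of_mem (mem_Ioi.2 (by linarith)), truncPowDiff,
      truncPow_of_pos _ (by linarith), truncPow_of_nonpos _ (by linarith),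
      truncPow_of_nonpos _ (by linarith)]
    ring_nf
  · rw [indicator_of_notMem (s := Ioi (0 : ℝ)) (a := η - 1) (by simpa using h1)]
    refine indicator_apply_eq_zero.2 fun h0 => ?_
    have h0 : 0 < η := h0
    rw [truncPowDiff, truncPow_of_nonpos _ (by linarith), truncPow_of_nonpos _ (by linarith),
      truncPow_of_nonpos _ (by linarith)]
    simp

theorem integrableOn_truncPowDiff_neg_one {a : ℝ} (ha0 : 0 < a) (ha1 : a < 1) :
    IntegrableOn (fun η => truncPowDiff a (-1) η / η ^ 2) (Ioi 0) := by
  refine Integrable.of_integral_ne_zero ?_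
  rw [integral_truncPowDiff_neg_one ha0 ha1]
  exact (mul_pi_div_sin_pos ha0 ha1).ne'

/-- The Mittag-Leffler expansion of the cotangent, multiplied by `-a`. -/
theorem hasSum_cot {a : ℝ} (ha0 : 0 < a) (ha1 : a < 1) :
    HasSum (fun n : ℕ => 2 * a ^ 2 / (((n : ℝ) + 1) ^ 2 - a ^ 2))
      (1 - a * Real.pi * Real.cot (Real.pi * a)) := by
  have hz : (a : ℂ) ∈ Complex.integerComplement := by
    rintro ⟨n, hn⟩
    have hn' : (n : ℝ) = a := by exact_mod_cast hn
    have h0 : (0 : ℝ) < n := by rw [hn']; exact ha0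
    have h1 : (n : ℝ) < 1 := by rw [hn']; exact ha1
    have h0' : 0 < n := by exact_mod_cast h0
    have h1' : n < 1 := by exact_mod_cast h1
    omega
  have hs := (summable_cotTerm hz).hasSum
  have e := cot_series_rep' hz
  simp only [cotTerm] at hs
  rw [← e] at hs
  have hs' : HasSum (fun n : ℕ => 1 / (a - (n + 1)) + 1 / (a + (n + 1)))
      (Real.pi * Real.cot (Real.pi * a) - 1 / a) := by
    rw [← Complex.hasSum_ofReal]
    push_cast
    exact hs
  have e1 : ∀ n : ℕ, 2 * a ^ 2 / (((n : ℝ) + 1) ^ 2 - a ^ 2) =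
      -a * (1 / (a - (n + 1)) + 1 / (a + (n + 1))) := fun n => by
    have h0 : (0 : ℝ) ≤ n := Nat.cast_nonneg n
    have h1 : a - (n + 1) ≠ 0 := by intro h; linarith
    have h2 : a + (n + 1) ≠ 0 := by positivity
    have h3 : ((n : ℝ) + 1) ^ 2 - a ^ 2 = -((a - (n + 1)) * (a + (n + 1))) := by ring
    rw [h3]
    field_simp
    ring
  have e2 : 1 - a * Real.pi * Real.cot (Real.pi * a) =
      -a * (Real.pi * Real.cot (Real.pi * a) - 1 / a) := by
    field_simp
    ring
  simp_rw [e1]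
  rw [e2]
  exact hs'.mul_left (-a)

theorem rpow_le_one_add_mul_sub {a x : ℝ} (ha0 : 0 ≤ a) (ha1 : a ≤ 1) (hx : 0 ≤ x) :
    x ^ a ≤ 1 + a * (x - 1) := by
  have := rpow_one_add_le_one_add_mul_self (s := x - 1) (by linarith) ha0 ha1
  rwa [add_sub_cancel] at this

theorem rpow_neg_le_one_add_mul_inv_sub {a x : ℝ} (ha0 : 0 ≤ a) (ha1 : a ≤ 1) (hx : 0 < x) :
    x ^ (-a) ≤ 1 + a * (1 / x - 1) := by
  have := rpow_le_one_add_mul_sub ha0 ha1 (x := 1 / x) (by positivity)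
  rwa [one_div, Real.inv_rpow hx.le, ← Real.rpow_neg hx.le, ← one_div] at this

theorem two_le_rpow_add_rpow_neg (a : ℝ) {x : ℝ} (hx : 0 < x) : 2 ≤ x ^ a + x ^ (-a) := by
  have h1 : x ^ a * x ^ (-a) = 1 := by rw [← Real.rpow_add hx]; simp
  have h2 : 0 < x ^ a := Real.rpow_pos_of_pos hx _
  have h3 : 0 < x ^ (-a) := Real.rpow_pos_of_pos hx _
  nlinarith [sq_nonneg (x ^ a - x ^ (-a)), sq_nonneg (x ^ a + x ^ (-a) - 2)]

theorem integral_Ioo_zero_one_rpow {b : ℝ} (hb : -1 < b) :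
    ∫ t in Ioo (0 : ℝ) 1, t ^ b = 1 / (b + 1) := by
  rw [← integral_Ioc_eq_integral_Ioo, ← intervalIntegral.integral_of_le zero_le_one,
    integral_rpow (Or.inl hb), Real.zero_rpow (by linarith)]
  simp

theorem integrableOn_Ioo_zero_one_rpow {b : ℝ} (hb : -1 < b) :
    IntegrableOn (fun t : ℝ => t ^ b) (Ioo 0 1) :=
  (intervalIntegral.integrableOn_Ioo_rpow_iff one_pos).2 hb

/-- Expand `1/(1-t)² = ∑ (n+1) t^n` and integrate term by term. All terms are nonnegative, since
`t^a + t^(-a) ≥ 2`, so summability of the integrals justifies the exchange; the resulting series is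
the one for the cotangent. -/
theorem integral_rpow_add_rpow_neg_sub_two {a : ℝ} (ha0 : 0 < a) (ha1 : a < 1) :
    ∫ t in Ioo (0 : ℝ) 1, (t ^ a + t ^ (-a) - 2) / (1 - t) ^ 2 =
      1 - a * Real.pi * Real.cot (Real.pi * a) := by
  set F : ℕ → ℝ → ℝ := fun n t =>
    ((n : ℝ) + 1) * (t ^ ((n : ℝ) + a) + t ^ ((n : ℝ) - a) - 2 * t ^ (n : ℝ)) with hF
  have hn : ∀ n : ℕ, (0 : ℝ) ≤ n := fun n => Nat.cast_nonneg n
  have hF' : ∀ n : ℕ, ∀ t ∈ Ioo (0 : ℝ) 1,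
      F n t = ((n : ℝ) + 1) * t ^ n * (t ^ a + t ^ (-a) - 2) := fun n t ht => by
    simp only [hF]
    rw [sub_eq_add_neg (n : ℝ) a, Real.rpow_add ht.1, Real.rpow_add ht.1, Real.rpow_natCast]
    ring
  have hi1 : ∀ n : ℕ, IntegrableOn (fun t : ℝ => t ^ ((n : ℝ) + a)) (Ioo 0 1) := fun n =>
    integrableOn_Ioo_zero_one_rpow (by linarith [hn n])
  have hi2 : ∀ n : ℕ, IntegrableOn (fun t : ℝ => t ^ ((n : ℝ) - a)) (Ioo 0 1) := fun n =>
    integrableOn_Ioo_zero_one_rpow (by linarith [hn n])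
  have hi3 : ∀ n : ℕ, IntegrableOn (fun t : ℝ => 2 * t ^ (n : ℝ)) (Ioo 0 1) := fun n =>
    (integrableOn_Ioo_zero_one_rpow (by linarith [hn n])).const_mul 2
  have hint : ∀ n, IntegrableOn (F n) (Ioo 0 1) := fun n =>
    (((hi1 n).add (hi2 n)).sub (hi3 n)).const_mul _
  have hval : ∀ n : ℕ, ∫ t in Ioo (0 : ℝ) 1, F n t = 2 * a ^ 2 / (((n : ℝ) + 1) ^ 2 - a ^ 2) := by
    intro n
    have h0 := hn n
    simp only [hF]
    have h12 : IntegrableOn (fun t : ℝ => t ^ ((n : ℝ) + a) + t ^ ((n : ℝ) - a)) (Ioo 0 1) :=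
      (hi1 n).add (hi2 n)
    rw [integral_const_mul, integral_sub h12 (hi3 n), integral_add (hi1 n) (hi2 n),
      integral_const_mul, integral_Ioo_zero_one_rpow (by linarith),
      integral_Ioo_zero_one_rpow (by linarith), integral_Ioo_zero_one_rpow (by linarith)]
    have h1 : (n : ℝ) + a + 1 ≠ 0 := by positivity
    have h2 : (n : ℝ) - a + 1 ≠ 0 := by intro h; linarith
    have h3 : ((n : ℝ) + 1) ^ 2 - a ^ 2 = (n + a + 1) * (n - a + 1) := by ring
    rw [h3]
    field_simp
    ring
  have hnorm : ∀ n : ℕ, ∫ t in Ioo (0 : ℝ) 1, ‖F n t‖ = ∫ t in Ioo (0 : ℝ) 1, F n t := by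
    intro n
    refine setIntegral_congr_fun measurableSet_Ioo fun t ht => Real.norm_of_nonneg ?_
    rw [hF' n t ht]
    have := two_le_rpow_add_rpow_neg a ht.1
    have h1 := hn n
    have h2 := ht.1
    exact mul_nonneg (by positivity) (by linarith)
  have hs := hasSum_integral_of_summable_integral_norm hint
    (by simp_rw [hnorm, hval]; exact (hasSum_cot ha0 ha1).summable)
  simp_rw [hval] at hs
  rw [← hs.unique (hasSum_cot ha0 ha1)]
  refine setIntegral_congr_fun measurableSet_Ioo fun t ht => ?_
  have h1 : HasSum (fun n : ℕ => ((n : ℝ) + 1) * t ^ n) (1 / (1 - t) ^ 2) := by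
    have h := hasSum_choose_mul_geometric_of_norm_lt_one (𝕜 := ℝ) 1 (r := t)
      (by rw [Real.norm_of_nonneg ht.1.le]; exact ht.2)
    simpa using h
  have h2 := h1.mul_right (t ^ a + t ^ (-a) - 2)
  rw [tsum_congr fun n => hF' n t ht, h2.tsum_eq]
  ring

theorem integral_rpow_add_rpow_neg_sub_two_pos {a : ℝ} (ha0 : 0 < a) (ha1 : a < 1) :
    0 < 1 - a * Real.pi * Real.cot (Real.pi * a) := by
  have h := hasSum_cot ha0 ha1
  have hp : ∀ n : ℕ, 0 < 2 * a ^ 2 / (((n : ℝ) + 1) ^ 2 - a ^ 2) := fun n => by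
    have h0 : (0 : ℝ) ≤ n := Nat.cast_nonneg n
    have : 0 < ((n : ℝ) + 1) ^ 2 - a ^ 2 := by nlinarith
    positivity
  rw [← h.tsum_eq]
  exact h.summable.tsum_pos (fun n => (hp n).le) 0 (hp 0)

theorem integrableOn_rpow_add_rpow_neg_sub_two {a : ℝ} (ha0 : 0 < a) (ha1 : a < 1) :
    IntegrableOn (fun t : ℝ => (t ^ a + t ^ (-a) - 2) / (1 - t) ^ 2) (Ioo 0 1) := by
  refine Integrable.of_integral_ne_zero ?_
  rw [integral_rpow_add_rpow_neg_sub_two ha0 ha1]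
  exact (integral_rpow_add_rpow_neg_sub_two_pos ha0 ha1).ne'

/-- Subtracting the linear Taylor part at `t = 1` makes the `t^a` and `t^(-a)` halves of the
previous integrand separately integrable; the linear parts cancel in the sum. Here the numerator
lies between `-(1-t)²` and `0`, by Bernoulli's inequality for `t^a` and for its reciprocal. -/
theorem integrableOn_rpow_sub_linear {a : ℝ} (ha0 : 0 < a) (ha1 : a < 1) :
    IntegrableOn (fun t : ℝ => (t ^ a - 1 + a * (1 - t)) / (1 - t) ^ 2) (Ioo 0 1) := by
  refine Measure.integrableOn_of_bounded (M := 1) (by simp)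
    (Measurable.aestronglyMeasurable (by fun_prop)) ?_
  refine (ae_restrict_iff' measurableSet_Ioo).2 (ae_of_all _ fun t ht => ?_)
  obtain ⟨h0, h1⟩ := ht
  have hu := rpow_le_one_add_mul_sub ha0.le ha1.le h0.le
  have hl := rpow_neg_le_one_add_mul_inv_sub ha0.le ha1.le h0
  have h2 : 0 < t ^ a := Real.rpow_pos_of_pos h0 _
  have h3 : t ^ a * t ^ (-a) = 1 := by rw [← Real.rpow_add h0]; simp
  have h4 : 0 < 1 - t := by linarith
  rw [Real.norm_eq_abs, abs_div, abs_of_nonneg (sq_nonneg (1 - t)), div_le_one (by positivity),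
    abs_of_nonpos (by linarith)]
  have h5 : 1 ≤ t ^ a * (1 + a * (1 / t - 1)) := by
    exact h3.ge.trans (mul_le_mul_of_nonneg_left hl h2.le)
  have h6 : t ≤ t ^ a * (t + a * (1 - t)) := by
    have := mul_le_mul_of_nonneg_left h5 h0.le
    have e : t * (t ^ a * (1 + a * (1 / t - 1))) = t ^ a * (t + a * (1 - t)) := by field_simp
    linarith
  have h7 : 0 < t + a * (1 - t) := by positivity
  have h8 : (1 - (1 - t) ^ 2 - a * (1 - t)) * (t + a * (1 - t)) ≤ t := by
    have : t - (1 - (1 - t) ^ 2 - a * (1 - t)) * (t + a * (1 - t)) =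
      (1 - t) ^ 2 * (t + a * (1 - t) - a + a ^ 2) := by ring
    have h9 : 0 ≤ t + a * (1 - t) - a + a ^ 2 := by nlinarith
    nlinarith [mul_nonneg (sq_nonneg (1 - t)) h9]
  nlinarith

theorem integrableOn_rpow_neg_sub_linear {a : ℝ} (ha0 : 0 < a) (ha1 : a < 1) :
    IntegrableOn (fun t : ℝ => (t ^ (-a) - 1 - a * (1 - t)) / (1 - t) ^ 2) (Ioo 0 1) := by
  refine ((integrableOn_rpow_add_rpow_neg_sub_two ha0 ha1).sub
    (integrableOn_rpow_sub_linear ha0 ha1)).congr_fun (fun t _ => ?_) measurableSet_Ioo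
  simp only [Pi.sub_apply]
  ring

theorem intervalIntegrable_one_iff_Ioo (f : ℝ → ℝ) :
    IntervalIntegrable f volume 0 1 ↔ IntegrableOn f (Ioo 0 1) := by
  rw [intervalIntegrable_iff_integrableOn_Ioc_of_le zero_le_one, integrableOn_Ioc_iff_integrableOn_Ioo]

theorem integral_Ioo_zero_one_comp_one_sub (f : ℝ → ℝ) :
    ∫ t in Ioo (0 : ℝ) 1, f (1 - t) = ∫ t in Ioo (0 : ℝ) 1, f t := by
  rw [← integral_Ioc_eq_integral_Ioo, ← integral_Ioc_eq_integral_Ioo,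
    ← intervalIntegral.integral_of_le zero_le_one, ← intervalIntegral.integral_of_le zero_le_one,
    intervalIntegral.integral_comp_sub_left]
  simp

theorem integrableOn_Ioo_zero_one_comp_one_sub {f : ℝ → ℝ} (hf : IntegrableOn f (Ioo 0 1)) :
    IntegrableOn (fun t => f (1 - t)) (Ioo 0 1) := by
  rw [← intervalIntegrable_one_iff_Ioo] at hf ⊢
  simpa using (hf.comp_sub_left 1).symm

theorem integrableOn_and_integral_Ioi_one_rational {a : ℝ} (ha : 0 < a) :
    IntegrableOn (fun η : ℝ => a / (η * (1 + η)) + 1 / η ^ 2) (Ioi 1) ∧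
    ∫ η in Ioi (1 : ℝ), (a / (η * (1 + η)) + 1 / η ^ 2) = a * Real.log 2 + 1 := by
  set Φ : ℝ → ℝ := fun η => a * (Real.log η - Real.log (1 + η)) - 1 / η
  have hd : ∀ η ∈ Ici (1 : ℝ), HasDerivAt Φ (a / (η * (1 + η)) + 1 / η ^ 2) η := by
    intro η hη
    have h0 : 0 < η := lt_of_lt_of_le one_pos hη
    have h1 := Real.hasDerivAt_log h0.ne'
    have h2 := ((hasDerivAt_id η).const_add 1).log (by simp only [id]; positivity)
    have h3 := (hasDerivAt_inv h0.ne')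
    have := ((h1.sub h2).const_mul a).sub h3
    have hΦ : Φ = (fun y => a * (Real.log - fun y => Real.log (1 + id y)) y) - fun y => y⁻¹ := by
      funext x; simp [Φ]
    rw [hΦ]
    refine this.congr_deriv ?_
    simp only [id]
    field_simp
    ring
  have hl : Tendsto Φ atTop (𝓝 0) := by
    have h1 : Tendsto (fun η : ℝ => Real.log (1 - 1 / (1 + η))) atTop (𝓝 (Real.log (1 - 0))) := by
      refine Tendsto.log (tendsto_const_nhds.sub ?_) (by norm_num)
      simp_rw [one_div]
      exact tendsto_inv_atTop_zero.comp (tendsto_atTop_add_const_left _ _ tendsto_id)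
    have h2 : Tendsto (fun η : ℝ => 1 / η) atTop (𝓝 0) := by
      simpa [one_div] using tendsto_inv_atTop_zero
    have h3 := (h1.const_mul a).sub h2
    simp only [sub_zero, Real.log_one, mul_zero] at h3
    refine h3.congr' ?_
    filter_upwards [eventually_gt_atTop 0] with η hη
    have : 1 - 1 / (1 + η) = η / (1 + η) := by field_simp; ring
    rw [this, Real.log_div hη.ne' (by positivity)]
  have hpos : ∀ η ∈ Ioi (1 : ℝ), 0 ≤ a / (η * (1 + η)) + 1 / η ^ 2 := fun η hη => by
    have : 0 < η := one_pos.trans hη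
    positivity
  refine ⟨integrableOn_Ioi_deriv_of_nonneg' hd hpos hl, ?_⟩
  rw [integral_Ioi_of_hasDerivAt_of_nonneg' hd hpos hl]
  simp only [Φ]
  norm_num
  ring

theorem integrableOn_and_integral_Ioo_div_one_add (a : ℝ) :
    IntegrableOn (fun η : ℝ => a / (1 + η)) (Ioo 0 1) ∧
    ∫ η in Ioo (0 : ℝ) 1, a / (1 + η) = a * Real.log 2 := by
  have hd : ∀ η ∈ uIcc (0 : ℝ) 1, HasDerivAt (fun η => a * Real.log (1 + η)) (a / (1 + η)) η := by
    intro η hη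
    rw [uIcc_of_le zero_le_one] at hη
    have h2 := (((hasDerivAt_id η).const_add 1).log (by simp only [id]; linarith [hη.1])).const_mul a
    simpa [div_eq_mul_inv] using h2
  have hi : IntervalIntegrable (fun η : ℝ => a / (1 + η)) volume 0 1 := by
    refine ContinuousOn.intervalIntegrable ?_
    rw [uIcc_of_le zero_le_one]
    exact continuousOn_const.div (by fun_prop) fun η hη => by linarith [hη.1]
  refine ⟨(intervalIntegrable_one_iff_Ioo _).1 hi, ?_⟩
  rw [← integral_Ioc_eq_integral_Ioo, ← intervalIntegral.integral_of_le zero_le_one,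
    intervalIntegral.integral_eq_sub_of_hasDerivAt hd hi]
  norm_num

/-- The term `(1+η)^(-a)` becomes `A` under `t = 1/(1+η)`, and `(1-η)₊^(-a)` becomes `B` under `t =
1-η`. The linear corrections do not cancel in the variable `η`; their defect is `a/(1+η)` on `(0,
1)` and `a/(η(1+η)) + 1/η²` on `(1, ∞)`. The contributions `a log 2` of the two defects cancel,
which leaves `∫ A + ∫ B - 1`. -/
theorem integrableOn_and_integral_truncPowDiff_one {a : ℝ} (ha0 : 0 < a) (ha1 : a < 1) :
    IntegrableOn (fun η => truncPowDiff a 1 η / η ^ 2) (Ioi 0) ∧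
    ∫ η in Ioi 0, truncPowDiff a 1 η / η ^ 2 = -(a * Real.pi * Real.cot (Real.pi * a)) := by
  set A : ℝ → ℝ := fun t => (t ^ a - 1 + a * (1 - t)) / (1 - t) ^ 2
  set B : ℝ → ℝ := fun t => (t ^ (-a) - 1 - a * (1 - t)) / (1 - t) ^ 2
  have hA := integrableOn_rpow_sub_linear ha0 ha1
  have hB := integrableOn_rpow_neg_sub_linear ha0 ha1
  have hA' := (integrableOn_Ioo_iff_integrableOn_Ioi_inv_one_add _).1 hA
  have hAv := integral_Ioo_eq_integral_Ioi_inv_one_add A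
  have hB' := integrableOn_Ioo_zero_one_comp_one_sub hB
  have hBv := integral_Ioo_zero_one_comp_one_sub B
  obtain ⟨hC, hCv⟩ := integrableOn_and_integral_Ioo_div_one_add a
  obtain ⟨hD, hDv⟩ := integrableOn_and_integral_Ioi_one_rational ha0
  have hAB : (∫ t in Ioo (0 : ℝ) 1, A t) + ∫ t in Ioo (0 : ℝ) 1, B t =
      1 - a * Real.pi * Real.cot (Real.pi * a) := by
    rw [← integral_rpow_add_rpow_neg_sub_two ha0 ha1, ← integral_add hA hB]
    refine setIntegral_congr_fun measurableSet_Ioo fun t _ => ?_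
    ring
  set E : ℝ → ℝ := (Ioo 0 1).indicator (fun η => B (1 - η) + a / (1 + η))
  set F : ℝ → ℝ := (Ioi 1).indicator (fun η => a / (η * (1 + η)) + 1 / η ^ 2)
  have hE : IntegrableOn E (Ioi 0) :=
    ((hB'.add hC).integrable_indicator measurableSet_Ioo).integrableOn
  have hF : IntegrableOn F (Ioi 0) := (hD.integrable_indicator measurableSet_Ioi).integrableOn
  have hEv : ∫ η in Ioi 0, E η = (∫ t in Ioo (0 : ℝ) 1, B t) + a * Real.log 2 := by
    rw [setIntegral_indicator measurableSet_Ioo, inter_eq_right.2 Ioo_subset_Ioi_self,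
      integral_add hB' hC, hCv, hBv]
  have hFv : ∫ η in Ioi 0, F η = a * Real.log 2 + 1 := by
    rw [setIntegral_indicator measurableSet_Ioi, inter_eq_right.2 (Ioi_subset_Ioi zero_le_one), hDv]
  have key : ∀ᵐ η ∂(volume.restrict (Ioi (0 : ℝ))),
      1 / (1 + η) ^ 2 * A (1 / (1 + η)) + E η - F η = truncPowDiff a 1 η / η ^ 2 := by
    have h1 : ∀ᵐ η : ℝ, η ≠ 1 := by simp [ae_iff, measure_singleton]
    refine (ae_restrict_iff' measurableSet_Ioi).2 (h1.mono fun η hη1 hη => ?_)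
    have hη : 0 < η := hη
    have e1 : 1 / (1 + η) ^ 2 * A (1 / (1 + η)) =
        ((1 + η) ^ (-a) - 1 + a * (η / (1 + η))) / η ^ 2 := by
      have h1 : 1 - 1 / (1 + η) = η / (1 + η) := by field_simp; ring
      simp only [A]
      rw [h1, one_div (1 + η), Real.inv_rpow (by positivity), ← Real.rpow_neg (by positivity)]
      field_simp
    rw [e1, truncPowDiff, truncPow_of_pos _ (by linarith), truncPow_of_pos _ one_pos, Real.one_rpow]
    rcases lt_or_gt_of_ne hη1 with h | h
    · have e2 : E η = B (1 - η) + a / (1 + η) := indicator_of_mem (show η ∈ Ioo (0 : ℝ) 1 from ⟨hη, h⟩) _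
      have e3 : F η = 0 := indicator_of_notMem (by simpa using h.le) _
      rw [e2, e3, truncPow_of_pos _ (by linarith)]
      simp only [B, sub_sub_cancel]
      field_simp
      ring
    · have e2 : E η = 0 := indicator_of_notMem (by simp; intro _; exact h.le) _
      have e3 : F η = a / (η * (1 + η)) + 1 / η ^ 2 := indicator_of_mem (show η ∈ Ioi (1 : ℝ) from h) _
      rw [e2, e3, truncPow_of_nonpos _ (by linarith)]
      field_simp
      ring
  have hAE : IntegrableOn (fun η => 1 / (1 + η) ^ 2 * A (1 / (1 + η)) + E η) (Ioi 0) := hA'.add hE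
  refine ⟨(hAE.sub hF).congr key, ?_⟩
  rw [← integral_congr_ae key, integral_sub hAE hF, integral_add hA' hE, ← hAv, hEv, hFv]
  linarith

/-! ### Integrability, mean value and homogeneity of the second difference -/

theorem one_sub_mul_le_rpow_neg {a x : ℝ} (ha0 : 0 ≤ a) (ha1 : a ≤ 1) (hx : 0 < x) :
    1 - a * (x - 1) ≤ x ^ (-a) := by
  have h1 := rpow_le_one_add_mul_sub ha0 ha1 hx.le
  have h2 : x ^ a * x ^ (-a) = 1 := by rw [← Real.rpow_add hx]; simp
  have h3 : 0 < x ^ (-a) := Real.rpow_pos_of_pos hx _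
  nlinarith [mul_le_mul_of_nonneg_right h1 h3.le, sq_nonneg (x ^ (-a) - 1),
    sq_nonneg (a * (x - 1)), sq_nonneg (x ^ (-a) - 1 + a * (x - 1))]

theorem integrableOn_truncPow_Iic {a : ℝ} (ha1 : a < 1) (T : ℝ) :
    IntegrableOn (truncPow a) (Iic T) := by
  have h1 : IntegrableOn (truncPow a) (Iic 0) :=
    integrableOn_zero.congr_fun (fun u hu => (truncPow_of_nonpos a hu).symm) measurableSet_Iic
  have h2 : IntegrableOn (truncPow a) (Ioc 0 T) := by
    have h3 : IntegrableOn (fun u : ℝ => u ^ (-a)) (Ioc 0 T) :=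
      (intervalIntegral.intervalIntegrable_rpow' (a := 0) (b := T) (by linarith)).1
    exact h3.congr_fun (fun u hu => (truncPow_of_pos a hu.1).symm) measurableSet_Ioc
  refine (h1.union h2).mono_set fun u hu => ?_
  rcases le_or_gt u 0 with h | h
  · exact Or.inl h
  · exact Or.inr ⟨h, hu⟩

/-- Neither term is integrable at infinity, as `a < 1`, but the difference is at most `a η s^(-1-a)`
there. -/
theorem integrable_truncPow_add_sub {a : ℝ} (ha0 : 0 < a) (ha1 : a < 1) {η : ℝ} (hη : 0 < η) :
    Integrable (fun s => truncPow a (s + η) - truncPow a s) := by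
  rw [← integrableOn_univ, ← Iic_union_Ioi (a := (1 : ℝ))]
  refine IntegrableOn.union ?_ ?_
  · refine IntegrableOn.sub ?_ (integrableOn_truncPow_Iic ha1 1)
    have h := (integrableOn_truncPow_Iic ha1 (1 + η)).integrable_indicator measurableSet_Iic
    have h' := h.comp_add_right η
    refine (h'.integrableOn (s := Iic 1)).congr_fun (fun s hs => ?_) measurableSet_Iic
    have hs : s ≤ 1 := hs
    exact indicator_of_mem (f := truncPow a) (mem_Iic.2 (by linarith : s + η ≤ 1 + η))
  · have h := (integrableOn_Ioi_rpow_of_lt (a := -1 - a) (c := (1 : ℝ)) (by linarith)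
      (by norm_num)).const_mul (a * η)
    refine h.mono' (by fun_prop) ((ae_restrict_iff' measurableSet_Ioi).2 (ae_of_all _ fun s hs => ?_))
    have hs : (0 : ℝ) < s := zero_lt_one.trans (mem_Ioi.1 hs)
    rw [truncPow_of_pos _ hs, truncPow_of_pos _ (by linarith), Real.norm_eq_abs, abs_sub_comm]
    have e : s + η = s * (1 + η / s) := by field_simp
    have h1 := one_sub_mul_le_rpow_neg ha0.le ha1.le (x := 1 + η / s) (by positivity)
    have h2 : (1 + η / s) ^ (-a) ≤ 1 :=
      Real.rpow_le_one_of_one_le_of_nonpos (by simp; positivity) (by linarith)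
    have h3 : 0 < s ^ (-a) := Real.rpow_pos_of_pos hs _
    have e2 : s ^ (-1 - a) = s ^ (-a) / s := by
      rw [show -1 - a = -a - 1 by ring, Real.rpow_sub_one hs.ne']
    rw [e, Real.mul_rpow hs.le (by positivity), abs_of_nonneg (by nlinarith), e2]
    calc s ^ (-a) - s ^ (-a) * (1 + η / s) ^ (-a) = s ^ (-a) * (1 - (1 + η / s) ^ (-a)) := by ring
      _ ≤ s ^ (-a) * (a * (η / s)) := by
        refine mul_le_mul_of_nonneg_left ?_ h3.le
        linarith
      _ = a * η * (s ^ (-a) / s) := by ring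

theorem integrable_truncPowDiff {a : ℝ} (ha0 : 0 < a) (ha1 : a < 1) {η : ℝ} (hη : 0 < η) :
    Integrable (fun s => truncPowDiff a s η) := by
  have h := integrable_truncPow_add_sub ha0 ha1 hη
  refine (h.sub (h.comp_sub_right η)).congr (ae_of_all _ fun s => ?_)
  simp only [Pi.sub_apply, sub_add_cancel, truncPowDiff]
  ring

/-- The second difference is a function minus its translate by `η`. Mean value zero is what allows
the constant `h r` to be subtracted inside the convolution in `truncPowConv_second_diff`. -/
theorem integral_truncPowDiff {a : ℝ} (ha0 : 0 < a) (ha1 : a < 1) {η : ℝ} (hη : 0 < η) :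
    ∫ s, truncPowDiff a s η = 0 := by
  have h := integrable_truncPow_add_sub ha0 ha1 hη
  have e : (fun s => truncPowDiff a s η) = fun s => (truncPow a (s + η) - truncPow a s) -
      (truncPow a (s - η + η) - truncPow a (s - η)) := by
    ext s; simp only [sub_add_cancel, truncPowDiff]; ring
  rw [e, integral_sub h (h.comp_sub_right η),
    integral_sub_right_eq_self (fun s => truncPow a (s + η) - truncPow a s), sub_self]

theorem truncPowDiff_mul_div_sq (a : ℝ) {l : ℝ} (hl : 0 < l) (s η : ℝ) :
    truncPowDiff a (l * s) η / η ^ 2 =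
      l ^ (-a) / l ^ 2 * (truncPowDiff a s (l⁻¹ * η) / (l⁻¹ * η) ^ 2) := by
  have h := truncPowDiff_mul a hl s (l⁻¹ * η)
  rw [mul_inv_cancel_left₀ hl.ne'] at h
  rw [h]
  rcases eq_or_ne η 0 with rfl | hη
  · simp
  · field_simp

theorem integrableOn_truncPowDiff_mul {a : ℝ} {l : ℝ} (hl : 0 < l) {s : ℝ}
    (hs : IntegrableOn (fun η => truncPowDiff a s η / η ^ 2) (Ioi 0)) :
    IntegrableOn (fun η => truncPowDiff a (l * s) η / η ^ 2) (Ioi 0) := by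
  simp_rw [truncPowDiff_mul_div_sq a hl s]
  refine Integrable.const_mul ?_ _
  have := (integrableOn_Ioi_comp_mul_left_iff (fun η => truncPowDiff a s η / η ^ 2) 0
    (inv_pos.2 hl)).2 (by simpa using hs)
  exact this

theorem rpow_scaling {a l : ℝ} (hl : 0 < l) : l ^ (-a) / l ^ 2 * l = l ^ (-1 - a) := by
  rw [show -1 - a = -a - 1 by ring, Real.rpow_sub_one hl.ne']
  field_simp

/-- Homogeneity reduces every base point `s ≠ 0` to `1` or `-1`. -/
theorem integral_truncPowDiff_mul (a : ℝ) {l : ℝ} (hl : 0 < l) (s : ℝ) :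
    ∫ η in Ioi 0, truncPowDiff a (l * s) η / η ^ 2 =
      l ^ (-1 - a) * ∫ η in Ioi 0, truncPowDiff a s η / η ^ 2 := by
  simp_rw [truncPowDiff_mul_div_sq a hl s]
  rw [integral_const_mul, integral_comp_mul_left_Ioi (fun η => truncPowDiff a s η / η ^ 2) 0
    (inv_pos.2 hl), ← rpow_scaling hl]
  simp [mul_assoc]

theorem integral_norm_truncPowDiff_mul (a : ℝ) {l : ℝ} (hl : 0 < l) (s : ℝ) :
    ∫ η in Ioi 0, ‖truncPowDiff a (l * s) η / η ^ 2‖ =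
      l ^ (-1 - a) * ∫ η in Ioi 0, ‖truncPowDiff a s η / η ^ 2‖ := by
  simp_rw [truncPowDiff_mul_div_sq a hl s]
  have h : 0 ≤ l ^ (-a) / l ^ 2 := by positivity
  simp_rw [norm_mul _ (truncPowDiff a s _ / _), Real.norm_of_nonneg h]
  rw [integral_const_mul, integral_comp_mul_left_Ioi (fun η => ‖truncPowDiff a s η / η ^ 2‖) 0
    (inv_pos.2 hl), ← rpow_scaling hl]
  simp [mul_assoc]

/-! ### Majorants and differentiation through integrated identities -/

/-- Integrable majorant of `f z * z ^ (-1 - a)` if `f` is `O(z)` at `0` and `O(z ^ p)` at `∞`. -/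
noncomputable def marchaudBound (a L B p δ z : ℝ) : ℝ :=
  if z ≤ δ then L * z ^ (-a) else B * ((1 + z) ^ p * z ^ (-1 - a))

theorem integrableOn_marchaudBound {a p δ : ℝ} (L B : ℝ) (ha1 : a < 1) (hp0 : 0 ≤ p) (hpa : p < a)
    (hδ : 0 < δ) : IntegrableOn (marchaudBound a L B p δ) (Ioi 0) := by
  rw [← Ioc_union_Ioi_eq_Ioi hδ.le]
  refine IntegrableOn.union ?_ ?_
  · have h3 : IntegrableOn (fun u : ℝ => L * u ^ (-a)) (Ioc 0 δ) :=
      (intervalIntegral.intervalIntegrable_rpow' (a := 0) (b := δ) (by linarith)).1.const_mul L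
    exact h3.congr_fun (fun u hu => (if_pos hu.2).symm) measurableSet_Ioc
  · have h := (integrableOn_Ioi_rpow_of_lt (a := p + (-1 - a)) (by linarith) hδ).const_mul
      (|B| * (1 / δ + 1) ^ p)
    have h' : IntegrableOn (fun z : ℝ => B * ((1 + z) ^ p * z ^ (-1 - a))) (Ioi δ) := by
      refine h.mono' (Measurable.aestronglyMeasurable (by fun_prop))
        ((ae_restrict_iff' measurableSet_Ioi).2 (ae_of_all _ fun z hz => ?_))
      have hz : δ < z := hz
      have hz0 : 0 < z := hδ.trans hz
      rw [norm_mul, Real.norm_eq_abs, Real.norm_of_nonneg (by positivity), mul_assoc,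
        Real.rpow_add hz0, ← mul_assoc ((1 / δ + 1) ^ p), ← Real.mul_rpow (by positivity) hz0.le]
      gcongr
      have : 1 ≤ z / δ := (one_le_div hδ).2 hz.le
      calc 1 + z ≤ z / δ + z := by linarith
        _ = (1 / δ + 1) * z := by ring
    exact h'.congr_fun (fun u hu => (if_neg (not_le.2 hu)).symm) measurableSet_Ioi

theorem norm_mul_rpow_le_marchaudBound {a L B p δ z f : ℝ} (hz : 0 < z)
    (h0 : z ≤ δ → |f| ≤ L * z) (h1 : δ < z → |f| ≤ B * (1 + z) ^ p) :
    ‖f * z ^ (-1 - a)‖ ≤ marchaudBound a L B p δ z := by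
  have hz' : 0 < z ^ (-1 - a) := Real.rpow_pos_of_pos hz _
  rw [norm_mul, Real.norm_eq_abs, Real.norm_of_nonneg hz'.le, marchaudBound]
  split_ifs with h
  · calc |f| * z ^ (-1 - a) ≤ L * z * z ^ (-1 - a) := by gcongr; exact h0 h
      _ = L * z ^ (-a) := by
        rw [show -1 - a = -a - 1 by ring, Real.rpow_sub_one hz.ne']; field_simp
  · rw [← mul_assoc]
    gcongr
    exact h1 (not_le.1 h)

/-- Derivatives of parameter integrals are found from their increments: Fubini yields the increment
as an integral of the candidate, and continuity of the candidate then gives the derivative. -/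
theorem hasDerivAt_of_sub_eq_integral {G M : ℝ → ℝ} (hM : ContinuousOn M (Ioi 0))
    (h : ∀ t₀ t₁, 0 < t₀ → t₀ ≤ t₁ → G t₁ - G t₀ = ∫ s in t₀..t₁, M s) {t : ℝ} (ht : 0 < t) :
    HasDerivAt G (M t) t := by
  have h2 : 0 < t / 2 := by positivity
  have hsub : uIcc (t / 2) t ⊆ Ioi 0 := by
    rw [uIcc_of_le (by linarith)]
    exact fun x hx => h2.trans_le hx.1
  have hd : HasDerivAt (fun u => ∫ s in (t / 2)..u, M s) (M t) t :=
    intervalIntegral.integral_hasDerivAt_right (hM.mono hsub).intervalIntegrable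
      (hM.stronglyMeasurableAtFilter isOpen_Ioi t ht) (hM.continuousAt (Ioi_mem_nhds ht))
  refine (hd.const_add (G (t / 2))).congr_of_eventuallyEq ?_
  filter_upwards [Ioi_mem_nhds (show t / 2 < t by linarith)] with u hu
  rw [← h (t / 2) u h2 (le_of_lt hu)]
  ring

theorem intervalIntegral_integral_swap_of_bound {k : ℝ → ℝ → ℝ} {bnd : ℝ → ℝ} {t₀ t₁ : ℝ}
    {S : Set ℝ} (h01 : t₀ ≤ t₁) (hS : MeasurableSet S)
    (hk : Measurable (Function.uncurry k)) (hbnd : IntegrableOn bnd S)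
    (hle : ∀ s ∈ Ioc t₀ t₁, ∀ u ∈ S, ‖k s u‖ ≤ bnd u) :
    ∫ s in t₀..t₁, ∫ u in S, k s u = ∫ u in S, ∫ s in t₀..t₁, k s u := by
  simp_rw [intervalIntegral.integral_of_le h01]
  refine integral_integral_swap ?_
  have hone : Integrable (fun _ : ℝ => (1 : ℝ)) (volume.restrict (Ioc t₀ t₁)) :=
    integrable_const 1
  refine (hone.mul_prod hbnd).mono' hk.aestronglyMeasurable ?_
  rw [Measure.prod_restrict]
  refine (ae_restrict_iff' (measurableSet_Ioc.prod hS)).2 (ae_of_all _ fun p hp => ?_)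
  simpa [Function.uncurry] using hle p.1 hp.1 p.2 hp.2

theorem measurable_of_continuousOn_Ioi_of_eq_zero {h : ℝ → ℝ} (h0 : ∀ r ≤ 0, h r = 0)
    (hc : ContinuousOn h (Ioi 0)) : Measurable h := by
  refine measurable_of_continuousOn_compl_singleton 0 fun x hx => ?_
  rcases lt_or_gt_of_ne hx with hx | hx
  · have : h =ᶠ[𝓝 x] fun _ => 0 := by
      filter_upwards [Iio_mem_nhds hx] with y hy using h0 y (le_of_lt hy)
    exact (continuousAt_const.congr this.symm).continuousWithinAt
  · exact (hc.continuousAt (Ioi_mem_nhds hx)).continuousWithinAt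

/-! ### Derivatives of the convolution with the truncated power -/

/-- Locally bounded functions vanishing on the negative half line: for every `M` the function is
bounded on `(-∞, M]`. -/
def BddOnIic (h : ℝ → ℝ) : Prop := ∀ M, ∃ B, ∀ r ≤ M, |h r| ≤ B

theorem BddOnIic.intervalIntegrable {h : ℝ → ℝ} (hb : BddOnIic h) (hm : Measurable h) (x y : ℝ) :
    IntervalIntegrable h volume x y := by
  obtain ⟨B, hB⟩ := hb (max x y)
  rw [intervalIntegrable_iff]
  refine Measure.integrableOn_of_bounded (M := B) (by simp)
    hm.aestronglyMeasurable ?_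
  exact (ae_restrict_iff' measurableSet_uIoc).2 (ae_of_all _ fun r hr => hB r hr.2)

/-- Convolution of `h` with the truncated power `u₊^(-a)`. -/
noncomputable def truncPowConv (a : ℝ) (h : ℝ → ℝ) (t : ℝ) : ℝ := ∫ u, truncPow a u * h (t - u)

theorem norm_truncPow_mul_le {a B t T : ℝ} {h : ℝ → ℝ} (h0 : ∀ r ≤ 0, h r = 0)
    (hB : ∀ r ≤ T, |h r| ≤ B) (ht : t ≤ T) (u : ℝ) :
    ‖truncPow a u * h (t - u)‖ ≤ B * (Iic T).indicator (truncPow a) u := by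
  have hB0 : 0 ≤ B := (abs_nonneg _).trans (hB T le_rfl)
  rcases le_or_gt u 0 with hu | hu
  · rw [truncPow_of_nonpos _ hu, zero_mul, norm_zero]
    exact mul_nonneg hB0 (indicator_nonneg (fun _ _ => truncPow_nonneg _ _) _)
  rcases le_or_gt u T with h1 | h1
  · rw [indicator_of_mem (show u ∈ Iic T from h1), norm_mul,
      Real.norm_of_nonneg (truncPow_nonneg _ _), mul_comm]
    exact mul_le_mul_of_nonneg_right (hB _ (by linarith)) (truncPow_nonneg _ _)
  · rw [h0 _ (by linarith), mul_zero, norm_zero]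
    exact mul_nonneg hB0 (indicator_nonneg (fun _ _ => truncPow_nonneg _ _) _)

theorem integrable_indicator_truncPow {a : ℝ} (ha1 : a < 1) (B T : ℝ) :
    Integrable (fun u => B * (Iic T).indicator (truncPow a) u) :=
  ((integrableOn_truncPow_Iic ha1 T).integrable_indicator measurableSet_Iic).const_mul B

theorem integrable_truncPow_mul {a : ℝ} (ha1 : a < 1) {h : ℝ → ℝ} (h0 : ∀ r ≤ 0, h r = 0)
    (hm : Measurable h) (hb : BddOnIic h) (t : ℝ) :
    Integrable (fun u => truncPow a u * h (t - u)) := by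
  obtain ⟨B, hB⟩ := hb t
  exact (integrable_indicator_truncPow ha1 B t).mono' (by fun_prop)
    (ae_of_all _ (norm_truncPow_mul_le h0 hB le_rfl))

theorem continuous_truncPowConv {a : ℝ} (ha1 : a < 1) {h : ℝ → ℝ} (h0 : ∀ r ≤ 0, h r = 0)
    (hc : ContinuousOn h (Ioi 0)) (hb : BddOnIic h) : Continuous (truncPowConv a h) := by
  have hm := measurable_of_continuousOn_Ioi_of_eq_zero h0 hc
  rw [continuous_iff_continuousAt]
  intro t
  obtain ⟨B, hB⟩ := hb (t + 1)
  refine continuousAt_of_dominated (bound := fun u => B * (Iic (t + 1)).indicator (truncPow a) u)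
    (Eventually.of_forall fun s => by fun_prop) ?_ (integrable_indicator_truncPow ha1 B (t + 1)) ?_
  · filter_upwards [Iio_mem_nhds (lt_add_one t)] with s hs
    exact ae_of_all _ (norm_truncPow_mul_le h0 hB (le_of_lt hs))
  -- The extension by zero may jump at `0`, which affects only the single point `u = t`.
  · have h1 : ∀ᵐ u : ℝ, u ≠ t := by simp [ae_iff, measure_singleton]
    filter_upwards [h1] with u hu
    refine continuousAt_const.mul ?_
    have hcont : ContinuousAt h (t - u) := by
      rcases lt_or_gt_of_ne (sub_ne_zero.2 hu.symm) with h2 | h2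
      · have : h =ᶠ[𝓝 (t - u)] fun _ => 0 := by
          filter_upwards [Iio_mem_nhds h2] with y hy using h0 y (le_of_lt hy)
        exact continuousAt_const.congr this.symm
      · exact hc.continuousAt (Ioi_mem_nhds h2)
    exact ContinuousAt.comp (f := fun s => s - u) hcont (by fun_prop)

theorem sub_eq_integral_of_tendsto_zero {h h' : ℝ → ℝ}
    (h0 : ∀ r ≤ 0, h r = 0) (h0' : ∀ r ≤ 0, h' r = 0) (hd : ∀ r > 0, HasDerivAt h (h' r) r)
    (hc : ContinuousOn h' (Ioi 0)) (hlim : Tendsto h (𝓝[>] 0) (𝓝 0)) (hb' : BddOnIic h') (x y : ℝ) :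
    h y - h x = ∫ s in x..y, h' s := by
  have hm' := measurable_of_continuousOn_Ioi_of_eq_zero h0' hc
  have hneg : ∀ r < 0, h =ᶠ[𝓝 r] fun _ => 0 := fun r hr => by
    filter_upwards [Iio_mem_nhds hr] with y hy using h0 y (le_of_lt hy)
  have hcont : Continuous h := by
    rw [continuous_iff_continuousAt]
    intro r
    rcases lt_trichotomy r 0 with hr | rfl | hr
    · exact continuousAt_const.congr (hneg r hr).symm
    · rw [continuousAt_iff_continuous_left'_right']
      constructor
      · refine (continuousWithinAt_const (b := (0 : ℝ))).congr (fun y hy => h0 y (le_of_lt hy))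
          (h0 0 le_rfl)
      · rw [ContinuousWithinAt, h0 0 le_rfl]; exact hlim
    · exact (hd r hr).continuousAt
  have hderiv : ∀ r, r ≠ 0 → HasDerivAt h (h' r) r := fun r hr => by
    rcases lt_or_gt_of_ne hr with h1 | h1
    · rw [h0' r h1.le]
      exact (hasDerivAt_const r (0 : ℝ)).congr_of_eventuallyEq (hneg r h1)
    · exact hd r h1
  exact (integral_eq_of_hasDerivAt_off_countable h h' (countable_singleton 0) hcont.continuousOn
      (fun r hr => hderiv r (by simpa using hr.2)) (hb'.intervalIntegrable hm' x y)).symm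

/-- Since `h(0+) = 0`, the extension by zero is a primitive of `h'` across the origin, so there is
no boundary term. -/
theorem hasDerivAt_truncPowConv_of_tendsto_zero {a : ℝ} (ha1 : a < 1) {h h' : ℝ → ℝ}
    (h0 : ∀ r ≤ 0, h r = 0) (h0' : ∀ r ≤ 0, h' r = 0) (hd : ∀ r > 0, HasDerivAt h (h' r) r)
    (hc : ContinuousOn h' (Ioi 0)) (hlim : Tendsto h (𝓝[>] 0) (𝓝 0)) (hb : BddOnIic h)
    (hb' : BddOnIic h') {t : ℝ} (ht : 0 < t) :
    HasDerivAt (truncPowConv a h) (truncPowConv a h' t) t := by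
  have hm' := measurable_of_continuousOn_Ioi_of_eq_zero h0' hc
  have hch : ContinuousOn h (Ioi 0) := fun r hr => (hd r hr).continuousAt.continuousWithinAt
  have hm := measurable_of_continuousOn_Ioi_of_eq_zero h0 hch
  have hftc := sub_eq_integral_of_tendsto_zero h0 h0' hd hc hlim hb'
  refine hasDerivAt_of_sub_eq_integral (continuous_truncPowConv ha1 h0' hc hb').continuousOn ?_ ht
  intro t₀ t₁ ht₀ h01
  obtain ⟨B, hB⟩ := hb' t₁
  have hswap := intervalIntegral_integral_swap_of_bound (S := univ)
    (k := fun s u => truncPow a u * h' (s - u)) h01 MeasurableSet.univ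
    (by unfold Function.uncurry; fun_prop) (integrable_indicator_truncPow ha1 B t₁).integrableOn
    (fun s hs u _ => norm_truncPow_mul_le h0' hB hs.2 u)
  simp only [Measure.restrict_univ] at hswap
  unfold truncPowConv
  rw [hswap, ← integral_sub (integrable_truncPow_mul ha1 h0 hm hb t₁)
    (integrable_truncPow_mul ha1 h0 hm hb t₀)]
  congr 1; ext u
  rw [intervalIntegral.integral_const_mul, intervalIntegral.integral_comp_sub_right, ← hftc]
  ring

/-- Fubini on `{w ≤ z}` with `∫_w^∞ z^(-1-b) dz = w^(-b)/b`. It serves with `b = a` for the Marchaud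
form and with `b = 1 + a` for the Riesz integral of order `1 + a`. -/
theorem hardy_integrableOn_and_integral {b : ℝ} (hb : 0 < b) {k : ℝ → ℝ} (hk : Measurable k)
    (hint : IntegrableOn (fun w => k w * w ^ (-b)) (Ioi 0)) :
    IntegrableOn (fun z => (∫ w in (0 : ℝ)..z, k w) * z ^ (-1 - b)) (Ioi 0) ∧
    ∫ z in Ioi 0, (∫ w in (0 : ℝ)..z, k w) * z ^ (-1 - b) =
      1 / b * ∫ w in Ioi 0, k w * w ^ (-b) := by
  set K : ℝ × ℝ → ℝ := {p : ℝ × ℝ | p.1 ≤ p.2}.indicator fun p => k p.1 * p.2 ^ (-1 - b) with hK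
  have hKm : Measurable K :=
    Measurable.indicator (by fun_prop) (measurableSet_le measurable_fst measurable_snd)
  have hK1 : ∀ w z, K (w, z) = (Ici w).indicator (fun z => k w * z ^ (-1 - b)) z := fun w z => by
    simp only [hK, indicator]; rfl
  have hK2 : ∀ w z, K (w, z) = (Iic z).indicator (fun w => k w * z ^ (-1 - b)) w := fun w z => by
    simp only [hK, indicator]; rfl
  have hset : ∀ w : ℝ, 0 < w → Ioi 0 ∩ Ici w = Ici w := fun w hw =>
    inter_eq_right.2 fun z hz => hw.trans_le hz
  have hpow : ∀ w : ℝ, 0 < w → ∫ z in Ici w, z ^ (-1 - b) = w ^ (-b) / b := fun w hw => by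
    rw [integral_Ici_eq_integral_Ioi, integral_Ioi_rpow_of_lt (by linarith) hw]
    rw [show -1 - b + 1 = -b by ring, neg_div_neg_eq]
  have hpowi : ∀ w : ℝ, 0 < w → IntegrableOn (fun z : ℝ => z ^ (-1 - b)) (Ici w) := fun w hw => by
    rw [integrableOn_Ici_iff_integrableOn_Ioi]
    exact integrableOn_Ioi_rpow_of_lt (by linarith) hw
  have hinner : ∀ w : ℝ, 0 < w → ∫ z in Ioi 0, K (w, z) = 1 / b * (k w * w ^ (-b)) :=
    fun w hw => by
    simp_rw [hK1]
    rw [setIntegral_indicator measurableSet_Ici, hset w hw, integral_const_mul, hpow w hw]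
    ring
  have hinnern : ∀ w : ℝ, 0 < w → ∫ z in Ioi 0, ‖K (w, z)‖ = 1 / b * ‖k w * w ^ (-b)‖ :=
    fun w hw => by
    simp_rw [hK1, norm_indicator_eq_indicator_norm]
    rw [setIntegral_indicator measurableSet_Ici, hset w hw,
      setIntegral_congr_fun (g := fun z => ‖k w‖ * z ^ (-1 - b)) measurableSet_Ici,
      integral_const_mul, hpow w hw, norm_mul,
      Real.norm_of_nonneg (Real.rpow_pos_of_pos hw _).le]
    · ring
    · intro z hz
      simp only [norm_mul]
      rw [Real.norm_of_nonneg (Real.rpow_pos_of_pos (hw.trans_le hz) _).le]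
  have hKi : Integrable K ((volume.restrict (Ioi 0)).prod (volume.restrict (Ioi 0))) := by
    refine (integrable_prod_iff hKm.aestronglyMeasurable).2 ⟨?_, ?_⟩
    · refine (ae_restrict_iff' measurableSet_Ioi).2 (ae_of_all _ fun w hw => ?_)
      simp_rw [hK1]
      have h1 : IntegrableOn (fun z : ℝ => k w * z ^ (-1 - b)) (Ici w) := (hpowi w hw).const_mul (k w)
      exact (h1.integrable_indicator measurableSet_Ici).integrableOn
    · exact (hint.norm.const_mul (1 / b)).congr
        ((ae_restrict_iff' measurableSet_Ioi).2 (ae_of_all _ fun w hw => (hinnern w hw).symm))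
  have houter : ∀ z : ℝ, 0 < z → ∫ w in Ioi 0, K (w, z) = (∫ w in (0 : ℝ)..z, k w) * z ^ (-1 - b) :=
    fun z hz => by
    simp_rw [hK2]
    rw [setIntegral_indicator measurableSet_Iic, Ioi_inter_Iic, integral_mul_const,
      intervalIntegral.integral_of_le hz.le]
  constructor
  · exact hKi.integral_prod_right.congr
      ((ae_restrict_iff' measurableSet_Ioi).2 (ae_of_all _ fun z hz => houter z hz))
  · have hswap := integral_integral_swap (f := fun w z => K (w, z)) hKi
    rw [setIntegral_congr_fun measurableSet_Ioi fun w hw => hinner w hw,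
      setIntegral_congr_fun measurableSet_Ioi fun w hw => houter w hw, integral_const_mul] at hswap
    exact hswap.symm

/-- The left-sided Marchaud integral `∫_0^∞ (h t - h (t - z)) z^(-1 - a) dz`. -/
noncomputable def marchaud (a : ℝ) (h : ℝ → ℝ) (t : ℝ) : ℝ :=
  ∫ z in Ioi 0, (h t - h (t - z)) * z ^ (-1 - a)

theorem exists_lipschitz_bound {h h' : ℝ → ℝ} (hd : ∀ r > 0, HasDerivAt h (h' r) r)
    (hc : ContinuousOn h' (Ioi 0)) {x y : ℝ} (hx : 0 < x) :
    ∃ L, ∀ r ∈ Icc x y, ∀ s ∈ Icc x y, |h s - h r| ≤ L * |s - r| := by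
  obtain ⟨L, hL⟩ := isCompact_Icc.exists_bound_of_continuousOn
    (hc.mono (fun r (hr : r ∈ Icc x y) => hx.trans_le hr.1))
  refine ⟨L, fun r hr s hs => ?_⟩
  exact (convex_Icc x y).norm_image_sub_le_of_norm_hasDerivWithin_le
    (fun u hu => (hd u (hx.trans_le hu.1)).hasDerivWithinAt) hL hr hs

theorem exists_marchaudBound {a : ℝ} {h h' : ℝ → ℝ} (hd : ∀ r > 0, HasDerivAt h (h' r) r)
    (hc : ContinuousOn h' (Ioi 0)) (hb : BddOnIic h) {t₀ : ℝ} (ht₀ : 0 < t₀) (t₁ : ℝ) :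
    ∃ L B, ∀ t ∈ Icc t₀ t₁, ∀ z > 0,
      ‖(h t - h (t - z)) * z ^ (-1 - a)‖ ≤ marchaudBound a L B 0 (t₀ / 2) z := by
  obtain ⟨B, hB⟩ := hb t₁
  -- For `z ≤ t₀/2` the point `t - z` stays in `[t₀/2, t₁]`, away from the origin, where `h` is
  -- Lipschitz.
  obtain ⟨L, hL⟩ := exists_lipschitz_bound hd hc (x := t₀ / 2) (y := t₁) (by positivity)
  refine ⟨L, 2 * B, fun t ht z hz => norm_mul_rpow_le_marchaudBound hz (fun hz' => ?_) fun hz' => ?_⟩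
  · have := hL (t - z) ⟨by linarith [ht.1], by linarith [ht.2]⟩ t ⟨by linarith [ht.1], ht.2⟩
    simpa [abs_of_pos hz] using this
  · rw [Real.rpow_zero, mul_one]
    have h1 := hB t ht.2
    have h2 := hB (t - z) (by linarith [ht.2])
    have := abs_sub (h t) (h (t - z))
    linarith

theorem integrableOn_marchaud {a : ℝ} (ha0 : 0 < a) (ha1 : a < 1) {h h' : ℝ → ℝ}
    (hm : Measurable h) (hd : ∀ r > 0, HasDerivAt h (h' r) r)
    (hc : ContinuousOn h' (Ioi 0)) (hb : BddOnIic h) {t : ℝ} (ht : 0 < t) :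
    IntegrableOn (fun z => (h t - h (t - z)) * z ^ (-1 - a)) (Ioi 0) := by
  obtain ⟨L, B, hLB⟩ := exists_marchaudBound (a := a) hd hc hb ht t
  exact (integrableOn_marchaudBound L B ha1 le_rfl ha0 (by positivity : 0 < t / 2)).mono'
    (Measurable.aestronglyMeasurable (by fun_prop))
    ((ae_restrict_iff' measurableSet_Ioi).2 (ae_of_all _ fun z hz => hLB t ⟨le_rfl, le_rfl⟩ z hz))

theorem continuousOn_marchaud {a : ℝ} (ha0 : 0 < a) (ha1 : a < 1) {h h' : ℝ → ℝ}
    (h0 : ∀ r ≤ 0, h r = 0) (hd : ∀ r > 0, HasDerivAt h (h' r) r)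
    (hc : ContinuousOn h' (Ioi 0)) (hb : BddOnIic h) :
    ContinuousOn (marchaud a h) (Ioi 0) := by
  have hch : ContinuousOn h (Ioi 0) := fun r hr => (hd r hr).continuousAt.continuousWithinAt
  have hm := measurable_of_continuousOn_Ioi_of_eq_zero h0 hch
  intro t ht
  have ht : 0 < t := ht
  refine ContinuousAt.continuousWithinAt ?_
  obtain ⟨L, B, hLB⟩ := exists_marchaudBound (a := a) hd hc hb (half_pos ht) (t + 1)
  refine continuousAt_of_dominated (bound := marchaudBound a L B 0 (t / 2 / 2))
    (Eventually.of_forall fun s => Measurable.aestronglyMeasurable (by fun_prop)) ?_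
    (integrableOn_marchaudBound L B ha1 le_rfl ha0 (by positivity)) ?_
  · filter_upwards [Ioo_mem_nhds (show t / 2 < t by linarith) (lt_add_one t)] with s hs
    exact (ae_restrict_iff' measurableSet_Ioi).2
      (ae_of_all _ fun z hz => hLB s ⟨hs.1.le, hs.2.le⟩ z hz)
  · have h1 : ∀ᵐ u : ℝ, u ≠ t := by simp [ae_iff, measure_singleton]
    refine ae_restrict_of_ae ?_
    filter_upwards [h1] with u hu
    have hcont : ContinuousAt h (t - u) := by
      rcases lt_or_gt_of_ne (sub_ne_zero.2 hu.symm) with h2 | h2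
      · have : h =ᶠ[𝓝 (t - u)] fun _ => 0 := by
          filter_upwards [Iio_mem_nhds h2] with y hy using h0 y (le_of_lt hy)
        exact continuousAt_const.congr this.symm
      · exact (hd _ h2).continuousAt
    have h3 : ContinuousAt (fun s => h (s - u)) t :=
      ContinuousAt.comp (f := fun s => s - u) hcont (by fun_prop)
    exact ((hd t ht).continuousAt.sub h3).mul continuousAt_const

theorem truncPow_mul_eq_indicator (a : ℝ) (k : ℝ → ℝ) :
    (fun u => truncPow a u * k u) = (Ioi 0).indicator fun w => k w * w ^ (-a) := by
  ext u
  by_cases hu : 0 < u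
  · rw [indicator_of_mem (show u ∈ Ioi (0 : ℝ) from hu), truncPow_of_pos _ hu, mul_comm]
  · rw [indicator_of_notMem (show u ∉ Ioi (0 : ℝ) from hu), truncPow_of_nonpos _ (not_lt.1 hu),
      zero_mul]

/-- Here `h'` may be unbounded near `0`, so the derivative cannot be moved onto `h`. Instead the
convolution is written as `a ∫ z^(-1-a) ∫_0^z h(t-w) dw dz`, and the inner integral has
`t`-derivative `h t - h (t - z)`. -/
theorem hasDerivAt_truncPowConv {a : ℝ} (ha0 : 0 < a) (ha1 : a < 1) {h h' : ℝ → ℝ}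
    (h0 : ∀ r ≤ 0, h r = 0) (hd : ∀ r > 0, HasDerivAt h (h' r) r)
    (hc : ContinuousOn h' (Ioi 0)) (hb : BddOnIic h) {t : ℝ} (ht : 0 < t) :
    HasDerivAt (truncPowConv a h) (a * marchaud a h t) t := by
  have hch : ContinuousOn h (Ioi 0) := fun r hr => (hd r hr).continuousAt.continuousWithinAt
  have hm := measurable_of_continuousOn_Ioi_of_eq_zero h0 hch
  have hii := hb.intervalIntegrable hm
  have hardy := fun s => hardy_integrableOn_and_integral ha0 (k := fun w => h (s - w)) (by fun_prop)
    (by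
      have := integrable_truncPow_mul ha1 h0 hm hb s
      rw [truncPow_mul_eq_indicator a fun u => h (s - u)] at this
      exact (integrable_indicator_iff measurableSet_Ioi).1 this)
  have hrep : ∀ s, truncPowConv a h s =
      a * ∫ z in Ioi 0, (∫ w in (0 : ℝ)..z, h (s - w)) * z ^ (-1 - a) := fun s => by
    rw [(hardy s).2, truncPowConv, truncPow_mul_eq_indicator a fun u => h (s - u),
      integral_indicator measurableSet_Ioi]
    field_simp
  refine hasDerivAt_of_sub_eq_integral (G := truncPowConv a h) (M := fun t => a * marchaud a h t)
    (continuousOn_const.mul (continuousOn_marchaud ha0 ha1 h0 hd hc hb)) ?_ ht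
  intro t₀ t₁ ht₀ h01
  obtain ⟨L, B, hLB⟩ := exists_marchaudBound (a := a) hd hc hb ht₀ t₁
  rw [hrep, hrep, ← mul_sub, ← integral_sub (hardy t₁).1 (hardy t₀).1,
    intervalIntegral.integral_const_mul]
  unfold marchaud
  rw [intervalIntegral_integral_swap_of_bound h01 measurableSet_Ioi
    (by unfold Function.uncurry; fun_prop)
    (integrableOn_marchaudBound L B ha1 le_rfl ha0 (half_pos ht₀))
    (fun s hs z hz => hLB s ⟨hs.1.le, hs.2⟩ z hz)]
  congr 1
  refine setIntegral_congr_fun measurableSet_Ioi fun z _ => ?_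
  rw [intervalIntegral.integral_mul_const, ← sub_mul,
    intervalIntegral.integral_sub (hii _ _) (by simpa using (hii (t₀ - z) (t₁ - z)).comp_sub_right z),
    intervalIntegral.integral_comp_sub_left, intervalIntegral.integral_comp_sub_left,
    intervalIntegral.integral_comp_sub_right]
  have e1 := intervalIntegral.integral_add_adjacent_intervals (hii (t₀ - z) (t₁ - z)) (hii (t₁ - z) t₁)
  have e2 := intervalIntegral.integral_add_adjacent_intervals (hii (t₀ - z) t₀) (hii t₀ t₁)
  congr 1
  simp only [sub_zero]
  linarith

/-! ### The second-difference integral of the convolution -/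

theorem nonneg_of_growth {h : ℝ → ℝ} {C p : ℝ} (hg : ∀ r > 0, |h r| ≤ C * (1 + r) ^ p) : 0 ≤ C := by
  have h1 := (abs_nonneg _).trans (hg 1 one_pos)
  by_contra hC
  have h2 : (0 : ℝ) < (1 + 1) ^ p := by positivity
  nlinarith

theorem abs_le_of_growth {h : ℝ → ℝ} {C p : ℝ} (hp : 0 ≤ p) (h0 : ∀ r ≤ 0, h r = 0)
    (hg : ∀ r > 0, |h r| ≤ C * (1 + r) ^ p) {r T : ℝ} (hT : 0 ≤ T) (hr : r ≤ T) :
    |h r| ≤ C * (1 + T) ^ p := by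
  have hC := nonneg_of_growth hg
  rcases le_or_gt r 0 with h1 | h1
  · rw [h0 r h1, abs_zero]; positivity
  · exact (hg r h1).trans (by gcongr)

theorem bddOnIic_of_growth {h : ℝ → ℝ} {C p : ℝ} (hp : 0 ≤ p) (h0 : ∀ r ≤ 0, h r = 0)
    (hg : ∀ r > 0, |h r| ≤ C * (1 + r) ^ p) : BddOnIic h := fun M =>
  ⟨C * (1 + |M|) ^ p, fun _ hr => abs_le_of_growth hp h0 hg (abs_nonneg M) (hr.trans (le_abs_self M))⟩

theorem integrableOn_forward_diff {a p C : ℝ} (ha1 : a < 1) (hp : 0 ≤ p) (hpa : p < a) {h h' : ℝ → ℝ}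
    (hm : Measurable h) (hd : ∀ r > 0, HasDerivAt h (h' r) r)
    (hc : ContinuousOn h' (Ioi 0)) (hg : ∀ r > 0, |h r| ≤ C * (1 + r) ^ p) {r : ℝ} (hr : 0 < r) :
    IntegrableOn (fun z => (h (r + z) - h r) * z ^ (-1 - a)) (Ioi 0) := by
  have hC := nonneg_of_growth hg
  obtain ⟨L, hL⟩ := exists_lipschitz_bound hd hc (x := r) (y := r + r) hr
  refine (integrableOn_marchaudBound L (2 * C * (1 + r) ^ p) ha1 hp hpa hr).mono'
    (Measurable.aestronglyMeasurable (by fun_prop))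
    ((ae_restrict_iff' measurableSet_Ioi).2 (ae_of_all _ fun z hz =>
      norm_mul_rpow_le_marchaudBound hz (fun hz' => ?_) fun hz' => ?_))
  · have hz : 0 < z := hz
    have := hL r ⟨le_rfl, by linarith⟩ (r + z) ⟨by linarith, by linarith⟩
    simpa [abs_of_pos hz] using this
  · have hz : 0 < z := hz
    have h1 := hg (r + z) (by linarith)
    have h2 := hg r hr
    -- `1 + r + z ≤ (1 + r)(1 + z)`; the growth exponent `p < a` then gives integrability at
    -- infinity.
    have h3 : (1 + (r + z)) ^ p ≤ (1 + r) ^ p * (1 + z) ^ p := by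
      rw [← Real.mul_rpow (by positivity) (by positivity)]
      exact Real.rpow_le_rpow (by positivity) (by nlinarith) hp
    have h4 : (1 + r) ^ p ≤ (1 + r) ^ p * (1 + z) ^ p :=
      le_mul_of_one_le_right (by positivity) (Real.one_le_rpow (by linarith) hp)
    have h5 := abs_sub (h (r + z)) (h r)
    nlinarith

/-- The right-sided integral `∫_0^∞ (h (t + z) - h t) z^(-1 - a) dz`. -/
noncomputable def marchaudRight (a : ℝ) (h : ℝ → ℝ) (t : ℝ) : ℝ :=
  ∫ z in Ioi 0, (h (t + z) - h t) * z ^ (-1 - a)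

/-- Translation of the integration variable moves the second difference from `h` to the kernel. -/
theorem truncPowConv_second_diff {a : ℝ} (ha0 : 0 < a) (ha1 : a < 1) {h : ℝ → ℝ}
    (h0 : ∀ r ≤ 0, h r = 0) (hm : Measurable h) (hb : BddOnIic h) (r : ℝ) {η : ℝ} (hη : 0 < η) :
    truncPowConv a h (r + η) + truncPowConv a h (r - η) - 2 * truncPowConv a h r =
      ∫ s, (h (r - s) - h r) * truncPowDiff a s η := by
  have hi := integrable_truncPow_mul ha1 h0 hm hb
  have hshift : ∀ c, Integrable (fun s => truncPow a (s + c) * h (r - s)) ∧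
      truncPowConv a h (r + c) = ∫ s, truncPow a (s + c) * h (r - s) := fun c => by
    have e : ∀ s, truncPow a (s + c) * h (r + c - (s + c)) = truncPow a (s + c) * h (r - s) :=
      fun s => by rw [add_sub_add_right_eq_sub]
    constructor
    · have := (hi (r + c)).comp_add_right c
      simpa only [e] using this
    · rw [truncPowConv, ← integral_add_right_eq_self (fun u => truncPow a u * h (r + c - u)) c]
      simp only [e]
  obtain ⟨i1, e1⟩ := hshift η
  obtain ⟨i2, e2⟩ := hshift (-η)
  obtain ⟨i3, e3⟩ := hshift 0
  simp only [add_zero] at i3 e3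
  rw [sub_eq_add_neg r η, e1, e2, e3, ← integral_const_mul]
  have i12 : Integrable (fun s => truncPow a (s + η) * h (r - s) + truncPow a (s + -η) * h (r - s)) :=
    i1.add i2
  have iK : Integrable (fun s => h r * truncPowDiff a s η) :=
    (integrable_truncPowDiff ha0 ha1 hη).const_mul _
  have i123 : Integrable (fun s => truncPow a (s + η) * h (r - s) +
      truncPow a (s + -η) * h (r - s) - 2 * (truncPow a s * h (r - s))) := i12.sub (i3.const_mul 2)
  rw [← integral_add i1 i2, ← integral_sub i12 (i3.const_mul 2)]
  have e4 : ∫ s, h r * truncPowDiff a s η = 0 := by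
    rw [integral_const_mul, integral_truncPowDiff ha0 ha1 hη, mul_zero]
  rw [← sub_zero (∫ s, _ - _), ← e4, ← integral_sub i123 iK]
  congr 1; ext s
  rw [truncPowDiff, ← sub_eq_add_neg]
  ring

theorem integrable_and_integral_of_halfLines {f f₁ f₂ : ℝ → ℝ} (h1 : IntegrableOn f₁ (Ioi 0))
    (h2 : IntegrableOn f₂ (Ioi 0)) (e1 : ∀ s > 0, f s = f₁ s) (e2 : ∀ s > 0, f (-s) = f₂ s) :
    Integrable f ∧ ∫ s, f s = (∫ s in Ioi 0, f₁ s) + ∫ s in Ioi 0, f₂ s := by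
  have i1 := h1.integrable_indicator measurableSet_Ioi
  have i2 := (h2.integrable_indicator measurableSet_Ioi).comp_neg
  have hae : ∀ᵐ s : ℝ, (Ioi 0).indicator f₁ s + (Ioi 0).indicator f₂ (-s) = f s := by
    have hne : ∀ᵐ s : ℝ, s ≠ 0 := by simp [ae_iff, measure_singleton]
    filter_upwards [hne] with s hs
    rcases lt_or_gt_of_ne hs with h | h
    · rw [indicator_of_notMem (by simpa using h.le), indicator_of_mem (by simpa using h), zero_add,
        ← e2 (-s) (by linarith), neg_neg]
    · rw [indicator_of_mem (by simpa using h), indicator_of_notMem (by simpa using h.le), add_zero,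
        e1 s h]
  refine ⟨(i1.add i2).congr hae, ?_⟩
  rw [← integral_congr_ae hae, integral_add i1 i2,
    integral_neg_eq_self (fun s => (Ioi 0).indicator f₂ s), integral_indicator measurableSet_Ioi,
    integral_indicator measurableSet_Ioi]

@[fun_prop]
theorem measurable_truncPowDiff (a : ℝ) : Measurable fun x : ℝ × ℝ => truncPowDiff a x.1 x.2 := by
  unfold truncPowDiff; fun_prop

/-- Fubini in `(s, η)`: the `η`-integral is a constant times `|s|^(-1-a)`, so `s > 0` produces the
left Marchaud integral and `s < 0` the right one. The same scaling for the norms gives absolute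
integrability. -/
theorem integrableOn_and_integral_second_diff {a p C : ℝ} (ha0 : 0 < a) (ha1 : a < 1) (hp : 0 ≤ p)
    (hpa : p < a) {h h' : ℝ → ℝ} (h0 : ∀ r ≤ 0, h r = 0) (hd : ∀ r > 0, HasDerivAt h (h' r) r)
    (hc : ContinuousOn h' (Ioi 0)) (hg : ∀ r > 0, |h r| ≤ C * (1 + r) ^ p) {r : ℝ} (hr : 0 < r) :
    IntegrableOn (fun η => (truncPowConv a h (r + η) + truncPowConv a h (r - η) -
      2 * truncPowConv a h r) / η ^ 2) (Ioi 0) ∧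
    ∫ η in Ioi 0, (truncPowConv a h (r + η) + truncPowConv a h (r - η) -
      2 * truncPowConv a h r) / η ^ 2 =
      a * Real.pi * Real.cot (Real.pi * a) * marchaud a h r +
      a * Real.pi / Real.sin (Real.pi * a) * marchaudRight a h r := by
  have hb := bddOnIic_of_growth hp h0 hg
  have hch : ContinuousOn h (Ioi 0) := fun r hr => (hd r hr).continuousAt.continuousWithinAt
  have hm := measurable_of_continuousOn_Ioi_of_eq_zero h0 hch
  obtain ⟨kp, kpv⟩ := integrableOn_and_integral_truncPowDiff_one ha0 ha1
  have kn := integrableOn_truncPowDiff_neg_one ha0 ha1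
  have knv := integral_truncPowDiff_neg_one ha0 ha1
  have m1 := integrableOn_marchaud ha0 ha1 hm hd hc hb hr
  have m2 := integrableOn_forward_diff ha1 hp hpa hm hd hc hg hr
  set f : ℝ × ℝ → ℝ := fun x => (h (r - x.1) - h r) * (truncPowDiff a x.1 x.2 / x.2 ^ 2) with hf
  have hfm : Measurable f := by
    have hmd := measurable_truncPowDiff a
    exact Measurable.mul (by fun_prop) (hmd.div (by fun_prop))
  have hk : ∀ s, s ≠ 0 → IntegrableOn (fun η => truncPowDiff a s η / η ^ 2) (Ioi 0) := fun s hs => by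
    rcases lt_or_gt_of_ne hs with h | h
    · have := integrableOn_truncPowDiff_mul (neg_pos.2 h) kn
      simpa using this
    · simpa using integrableOn_truncPowDiff_mul h kp
  have hfi : Integrable f (volume.prod (volume.restrict (Ioi 0))) := by
    refine (integrable_prod_iff hfm.aestronglyMeasurable).2 ⟨?_, ?_⟩
    · have hne : ∀ᵐ s : ℝ, s ≠ 0 := by simp [ae_iff, measure_singleton]
      filter_upwards [hne] with s hs
      exact (hk s hs).const_mul (h (r - s) - h r)
    · refine (integrable_and_integral_of_halfLines
        (m1.norm.mul_const (∫ η in Ioi 0, ‖truncPowDiff a 1 η / η ^ 2‖))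
        (m2.norm.mul_const (∫ η in Ioi 0, ‖truncPowDiff a (-1) η / η ^ 2‖)) ?_ ?_).1
      · intro s hs
        have := integral_norm_truncPowDiff_mul a hs 1
        rw [mul_one] at this
        simp only [hf, norm_mul (h _ - _)]
        rw [integral_const_mul, this, norm_sub_rev,
          Real.norm_of_nonneg (Real.rpow_pos_of_pos hs _).le]
        ring
      · intro s hs
        have := integral_norm_truncPowDiff_mul a hs (-1)
        rw [mul_neg_one] at this
        simp only [hf, norm_mul (h _ - _)]
        rw [integral_const_mul, this, sub_neg_eq_add,
          Real.norm_of_nonneg (Real.rpow_pos_of_pos hs _).le]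
        ring
  have hinner : ∀ η ∈ Ioi (0 : ℝ), ∫ s, f (s, η) = (truncPowConv a h (r + η) +
      truncPowConv a h (r - η) - 2 * truncPowConv a h r) / η ^ 2 := fun η hη => by
    rw [truncPowConv_second_diff ha0 ha1 h0 hm hb r hη, ← integral_div]
    simp only [hf, mul_div_assoc]
  refine ⟨hfi.integral_prod_right.congr
    ((ae_restrict_iff' measurableSet_Ioi).2 (ae_of_all _ hinner)), ?_⟩
  rw [← setIntegral_congr_fun measurableSet_Ioi hinner,
    ← integral_integral_swap (f := fun s η => f (s, η)) hfi,
    (integrable_and_integral_of_halfLines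
      (m1.mul_const (a * Real.pi * Real.cot (Real.pi * a)))
      (m2.mul_const (a * Real.pi / Real.sin (Real.pi * a))) ?_ ?_).2, integral_mul_const,
    integral_mul_const, marchaud, marchaudRight]
  · ring
  · intro s hs
    have := integral_truncPowDiff_mul a hs 1
    rw [mul_one, kpv] at this
    simp only [hf]
    rw [integral_const_mul, this]
    ring
  · intro s hs
    have := integral_truncPowDiff_mul a hs (-1)
    rw [mul_neg_one, knv] at this
    simp only [hf]
    rw [integral_const_mul, this, sub_neg_eq_add]
    ring

/-! ### The integral against the regular kernel at the reflected point -/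

theorem integrableOn_mul_add_rpow {a p C : ℝ} (ha0 : 0 < a) (ha1 : a < 1) (hp : 0 ≤ p)
    (hpa : p < a) {h : ℝ → ℝ} (hm : Measurable h) (hg : ∀ r > 0, |h r| ≤ C * (1 + r) ^ p)
    {r : ℝ} (hr : 0 < r) :
    IntegrableOn (fun τ => h τ * (τ + r) ^ (-1 - a)) (Ioi 0) := by
  have hC := nonneg_of_growth hg
  refine (integrableOn_marchaudBound (δ := 1) (C * (1 + 1) ^ p * r ^ (-1 - a)) C ha1 hp hpa
    one_pos).mono' (Measurable.aestronglyMeasurable (by fun_prop))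
    ((ae_restrict_iff' measurableSet_Ioi).2 (ae_of_all _ fun z hz => ?_))
  have hz : 0 < z := hz
  rw [norm_mul, Real.norm_eq_abs, Real.norm_of_nonneg (by positivity), marchaudBound]
  split_ifs with h1
  · have h2 : 1 ≤ z ^ (-a) := Real.one_le_rpow_of_pos_of_le_one_of_nonpos hz h1 (by linarith)
    calc |h z| * (z + r) ^ (-1 - a) ≤ C * (1 + 1) ^ p * r ^ (-1 - a) := by
          refine mul_le_mul ((hg z hz).trans (by gcongr)) ?_ (by positivity) (by positivity)
          exact Real.rpow_le_rpow_of_nonpos hr (by linarith) (by linarith)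
      _ ≤ _ := le_mul_of_one_le_right (by positivity) h2
  · rw [← mul_assoc]
    refine mul_le_mul (hg z hz) ?_ (by positivity) (by positivity)
    exact Real.rpow_le_rpow_of_nonpos hz (by linarith) (by linarith)

theorem truncPow_div_scaling (a : ℝ) {l : ℝ} (hl : 0 < l) {u : ℝ} (hu : 0 < u) :
    truncPow a u / (u + l) ^ 2 =
      l ^ (-a) / l ^ 2 * ((l⁻¹ * u) ^ (-a) / (1 + l⁻¹ * u) ^ 2) := by
  have hl' : 0 < l ^ (-a) := Real.rpow_pos_of_pos hl _
  have e : truncPow a u = l ^ (-a) * (l⁻¹ * u) ^ (-a) := by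
    rw [← Real.mul_rpow hl.le (by positivity), mul_inv_cancel_left₀ hl.ne', truncPow_of_pos _ hu]
  rw [e]
  field_simp
  ring

theorem integrableOn_and_integral_truncPow_div_sq {a : ℝ} (ha0 : 0 < a) (ha1 : a < 1) {l : ℝ}
    (hl : 0 < l) :
    IntegrableOn (fun u => truncPow a u / (u + l) ^ 2) (Ioi 0) ∧
    ∫ u in Ioi 0, truncPow a u / (u + l) ^ 2 =
      l ^ (-1 - a) * (a * Real.pi / Real.sin (Real.pi * a)) := by
  have hc : EqOn (fun u => truncPow a u / (u + l) ^ 2)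
    (fun u => l ^ (-a) / l ^ 2 * ((l⁻¹ * u) ^ (-a) / (1 + l⁻¹ * u) ^ 2)) (Ioi 0) := fun u hu =>
      truncPow_div_scaling a hl hu
  constructor
  · rw [integrableOn_congr_fun hc measurableSet_Ioi]
    refine Integrable.const_mul ?_ _
    have := (integrableOn_Ioi_comp_mul_left_iff (fun u : ℝ => u ^ (-a) / (1 + u) ^ 2) 0
      (inv_pos.2 hl)).2 (by simpa using integrableOn_rpow_neg_div_one_add_sq ha0 ha1)
    exact this
  · rw [setIntegral_congr_fun measurableSet_Ioi hc, integral_const_mul,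
      integral_comp_mul_left_Ioi (fun u : ℝ => u ^ (-a) / (1 + u) ^ 2) 0 (inv_pos.2 hl), mul_zero,
      integral_rpow_neg_div_one_add_sq ha0 ha1, ← rpow_scaling hl]
    simp [mul_assoc]

theorem integrableOn_and_integral_truncPow_sub_div_sq {a : ℝ} (ha0 : 0 < a) (ha1 : a < 1)
    {τ r : ℝ} (hτ : 0 < τ) (hr : 0 < r) :
    IntegrableOn (fun ξ => truncPow a (ξ - τ) / (ξ + r) ^ 2) (Ioi 0) ∧
    ∫ ξ in Ioi 0, truncPow a (ξ - τ) / (ξ + r) ^ 2 =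
      (τ + r) ^ (-1 - a) * (a * Real.pi / Real.sin (Real.pi * a)) := by
  obtain ⟨h1, h2⟩ := integrableOn_and_integral_truncPow_div_sq ha0 ha1 (l := τ + r) (by positivity)
  have e1 : (Ioi 0).indicator (fun ξ => truncPow a (ξ - τ) / (ξ + r) ^ 2) =
      fun ξ => (Ioi 0).indicator (fun u => truncPow a u / (u + (τ + r)) ^ 2) (ξ - τ) := by
    ext ξ
    by_cases h : 0 < ξ - τ
    · rw [indicator_of_mem (show ξ ∈ Ioi 0 from mem_Ioi.2 (by linarith)),
        indicator_of_mem (show ξ - τ ∈ Ioi 0 from h)]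
      ring_nf
    · rw [indicator_of_notMem (show ξ - τ ∉ Ioi 0 from h)]
      refine indicator_apply_eq_zero.2 fun _ => ?_
      rw [truncPow_of_nonpos _ (not_lt.1 h), zero_div]
  rw [← integrable_indicator_iff measurableSet_Ioi, ← integral_indicator measurableSet_Ioi, e1,
    integral_sub_right_eq_self ((Ioi 0).indicator (fun u => truncPow a u / (u + (τ + r)) ^ 2)) τ,
    integral_indicator measurableSet_Ioi, h2]
  exact ⟨(h1.integrable_indicator measurableSet_Ioi).comp_sub_right τ, rfl⟩

theorem truncPowConv_eq_integral_Ioi (a : ℝ) {h : ℝ → ℝ} (h0 : ∀ r ≤ 0, h r = 0) (t : ℝ) :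
    truncPowConv a h t = ∫ τ in Ioi 0, h τ * truncPow a (t - τ) := by
  rw [truncPowConv, ← integral_sub_left_eq_self _ volume t, ← integral_indicator measurableSet_Ioi]
  congr 1; ext τ
  rw [sub_sub_cancel, mul_comm]
  by_cases hτ : 0 < τ
  · rw [indicator_of_mem (show τ ∈ Ioi 0 from hτ)]
  · rw [indicator_of_notMem (show τ ∉ Ioi 0 from hτ), h0 τ (not_lt.1 hτ), zero_mul]

/-- After exchanging the integrals, the shift `u = ξ - τ` leaves `u^(-a)/(u + τ + r)²`, and scaling
by `τ + r` reduces this to the Beta integral. -/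
theorem integrableOn_and_integral_truncPowConv_div_sq {a p C : ℝ} (ha0 : 0 < a) (ha1 : a < 1)
    (hp : 0 ≤ p) (hpa : p < a) {h : ℝ → ℝ} (h0 : ∀ r ≤ 0, h r = 0) (hm : Measurable h)
    (hg : ∀ r > 0, |h r| ≤ C * (1 + r) ^ p) {r : ℝ} (hr : 0 < r) :
    IntegrableOn (fun ξ => truncPowConv a h ξ / (ξ + r) ^ 2) (Ioi 0) ∧
    ∫ ξ in Ioi 0, truncPowConv a h ξ / (ξ + r) ^ 2 =
      a * Real.pi / Real.sin (Real.pi * a) * ∫ τ in Ioi 0, h τ * (τ + r) ^ (-1 - a) := by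
  have hi := integrableOn_mul_add_rpow ha0 ha1 hp hpa hm hg hr
  set f : ℝ × ℝ → ℝ := fun x => h x.1 * (truncPow a (x.2 - x.1) / (x.2 + r) ^ 2) with hf
  have hfm : Measurable f := by
    exact Measurable.mul (by fun_prop) (Measurable.div (by fun_prop) (by fun_prop))
  have hfi : Integrable f ((volume.restrict (Ioi 0)).prod (volume.restrict (Ioi 0))) := by
    refine (integrable_prod_iff hfm.aestronglyMeasurable).2 ⟨?_, ?_⟩
    · refine (ae_restrict_iff' measurableSet_Ioi).2 (ae_of_all _ fun τ hτ => ?_)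
      exact (integrableOn_and_integral_truncPow_sub_div_sq ha0 ha1 hτ hr).1.const_mul (h τ)
    · refine (hi.norm.mul_const (a * Real.pi / Real.sin (Real.pi * a))).congr
        ((ae_restrict_iff' measurableSet_Ioi).2 (ae_of_all _ fun τ hτ => ?_))
      have hτ : 0 < τ := hτ
      have hn : ∀ ξ, ‖truncPow a (ξ - τ) / (ξ + r) ^ 2‖ = truncPow a (ξ - τ) / (ξ + r) ^ 2 :=
        fun ξ => Real.norm_of_nonneg (div_nonneg (truncPow_nonneg _ _) (sq_nonneg _))
      simp only [hf, norm_mul (h _), hn]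
      rw [integral_const_mul, (integrableOn_and_integral_truncPow_sub_div_sq ha0 ha1 hτ hr).2,
        Real.norm_of_nonneg (show 0 ≤ (τ + r) ^ (-1 - a) by positivity)]
      ring
  have hinner : ∀ ξ ∈ Ioi (0 : ℝ), ∫ τ in Ioi 0, f (τ, ξ) = truncPowConv a h ξ / (ξ + r) ^ 2 :=
    fun ξ hξ => by
    rw [truncPowConv_eq_integral_Ioi a h0, ← integral_div]
    simp only [hf, mul_div_assoc]
  refine ⟨hfi.integral_prod_right.congr
    ((ae_restrict_iff' measurableSet_Ioi).2 (ae_of_all _ hinner)), ?_⟩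
  rw [← setIntegral_congr_fun measurableSet_Ioi hinner,
    ← integral_integral_swap (f := fun s η => f (s, η)) hfi, mul_comm, ← integral_mul_const]
  refine setIntegral_congr_fun measurableSet_Ioi fun τ hτ => ?_
  simp only [hf]
  rw [integral_const_mul, (integrableOn_and_integral_truncPow_sub_div_sq ha0 ha1 hτ hr).2]
  ring

theorem abs_truncPowConv_le {a p C : ℝ} (ha1 : a < 1) (hp : 0 ≤ p) {h : ℝ → ℝ}
    (h0 : ∀ r ≤ 0, h r = 0) (hg : ∀ r > 0, |h r| ≤ C * (1 + r) ^ p) {t : ℝ} (ht : 0 < t) :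
    |truncPowConv a h t| ≤ C / (1 - a) * (1 + t) ^ p * t ^ (1 - a) := by
  have hB : ∀ r ≤ t, |h r| ≤ C * (1 + t) ^ p := fun r hr => abs_le_of_growth hp h0 hg ht.le hr
  have h1 := norm_integral_le_of_norm_le (integrable_indicator_truncPow ha1 (C * (1 + t) ^ p) t)
    (ae_of_all _ (norm_truncPow_mul_le (a := a) h0 hB le_rfl))
  have h2 : ∫ u, (Iic t).indicator (truncPow a) u = t ^ (1 - a) / (1 - a) := by
    have e : (Iic t).indicator (truncPow a) = (Ioc 0 t).indicator fun u => u ^ (-a) := by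
      ext u
      simp only [indicator, truncPow, mem_Iic, mem_Ioc]
      by_cases h3 : u ≤ t <;> by_cases h4 : 0 < u <;> simp [h3, h4]
    rw [e, integral_indicator measurableSet_Ioc, ← intervalIntegral.integral_of_le ht.le,
      integral_rpow (Or.inl (by linarith)), Real.zero_rpow (by linarith)]
    rw [sub_zero, neg_add_eq_sub]
  rw [integral_const_mul, h2] at h1
  refine h1.trans (le_of_eq ?_)
  ring

/-! ### Principal values by integration by parts -/

theorem HasPVIntegral.of_primitive {F Φ : ℝ → ℝ} {r l₀ l₁ d : ℝ} (hr : 0 < r)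
    (hd : ∀ ξ > 0, ξ ≠ r → HasDerivAt Φ (F ξ) ξ) (hc : ContinuousOn F (Ioi 0 \ {r}))
    (h0 : Tendsto Φ (𝓝[>] 0) (𝓝 l₀)) (h1 : Tendsto Φ atTop (𝓝 l₁))
    (hj : Tendsto (fun ε => Φ (r - ε) - Φ (r + ε)) (𝓝[>] 0) (𝓝 d)) :
    HasPVIntegral F r (d - l₀ + l₁) := by
  refine ⟨hc.locallyIntegrableOn (measurableSet_Ioi.diff (measurableSet_singleton r)), ?_⟩
  have hftc : ∀ x y, x ≤ y → uIcc x y ⊆ Ioi 0 \ {r} → ∫ ξ in x..y, F ξ = Φ y - Φ x :=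
    fun x y _ hs => intervalIntegral.integral_eq_sub_of_hasDerivAt
      (fun ξ hξ => hd ξ (hs hξ).1 (hs hξ).2) (hc.mono hs).intervalIntegrable
  have t0 : Tendsto (fun p : ℝ × ℝ × ℝ => Φ p.1) (𝓝[>] 0 ×ˢ (𝓝[>] 0 ×ˢ atTop)) (𝓝 l₀) :=
    h0.comp tendsto_fst
  have t1 : Tendsto (fun p : ℝ × ℝ × ℝ => Φ p.2.2) (𝓝[>] 0 ×ˢ (𝓝[>] 0 ×ˢ atTop)) (𝓝 l₁) :=
    h1.comp (tendsto_snd.comp tendsto_snd)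
  have tj : Tendsto (fun p : ℝ × ℝ × ℝ => Φ (r - p.2.1) - Φ (r + p.2.1))
      (𝓝[>] 0 ×ˢ (𝓝[>] 0 ×ˢ atTop)) (𝓝 d) :=
    hj.comp (tendsto_fst.comp tendsto_snd)
  refine ((tj.sub t0).add t1).congr' ?_
  have e0 : ∀ᶠ x : ℝ in 𝓝[>] 0, x ∈ Ioo 0 (r / 2) := Ioo_mem_nhdsGT (half_pos hr)
  filter_upwards [e0.prod_mk (e0.prod_mk (eventually_gt_atTop (2 * r)))] with p hp
  obtain ⟨⟨h2, h3⟩, ⟨h4, h5⟩, h6⟩ := hp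
  rw [hftc p.1 (r - p.2.1) (by linarith), hftc (r + p.2.1) p.2.2 (by linarith)]
  · ring
  · rw [uIcc_of_le (by linarith)]
    exact fun ξ hξ => ⟨by have := hξ.1; simp only [mem_Ioi]; linarith, fun h => by
      have := hξ.1; rw [mem_singleton_iff.1 h] at this; linarith⟩
  · rw [uIcc_of_le (by linarith)]
    exact fun ξ hξ => ⟨by have := hξ.1; simp only [mem_Ioi]; linarith, fun h => by
      have := hξ.2; rw [mem_singleton_iff.1 h] at this; linarith⟩

theorem hasDerivAt_setIntegral_Ioi {A : ℝ → ℝ} {b c : ℝ} (hbc : b < c) (hA : IntegrableOn A (Ioi b))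
    (hc : ContinuousOn A (Ioi b)) : HasDerivAt (fun x => ∫ η in Ioi x, A η) (-A c) c := by
  have hsub : uIcc c c ⊆ Ioi b := by simpa using hbc
  have hd : HasDerivAt (fun u => ∫ s in c..u, A s) (A c) c :=
    intervalIntegral.integral_hasDerivAt_right (hc.mono hsub).intervalIntegrable
      (hc.stronglyMeasurableAtFilter isOpen_Ioi c hbc) (hc.continuousAt (Ioi_mem_nhds hbc))
  refine (hd.const_sub (∫ η in Ioi c, A η)).congr_of_eventuallyEq ?_
  filter_upwards [Ioi_mem_nhds hbc] with u hu
  have := intervalIntegral.integral_Ioi_sub_Ioi' (hA.mono_set (Ioi_subset_Ioi hbc.le))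
    (hA.mono_set (Ioi_subset_Ioi (le_of_lt hu)))
  linarith

theorem tendsto_setIntegral_Ioi_atTop {A : ℝ → ℝ} {b : ℝ} (hA : IntegrableOn A (Ioi b)) :
    Tendsto (fun x => ∫ η in Ioi x, A η) atTop (𝓝 0) := by
  have h := (intervalIntegral_tendsto_integral_Ioi b hA tendsto_id).const_sub (∫ η in Ioi b, A η)
  rw [sub_self] at h
  refine h.congr' ?_
  filter_upwards [eventually_ge_atTop b] with x hx
  have := intervalIntegral.integral_Ioi_sub_Ioi hA hx
  simp only [id]
  linarith

theorem tendsto_setIntegral_Ioi_nhdsGT {A : ℝ → ℝ} (hA : IntegrableOn A (Ioi 0)) :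
    Tendsto (fun x => ∫ η in Ioi x, A η) (𝓝[>] 0) (𝓝 (∫ η in Ioi 0, A η)) := by
  have hi := hA.integrable_indicator measurableSet_Ioi
  have h := (intervalIntegral.continuous_primitive (fun x y => hi.intervalIntegrable (a := x) (b := y)) 0).tendsto 0
  have h' := (h.mono_left (nhdsWithin_le_nhds (s := Ioi 0))).const_sub (∫ η in Ioi 0, A η)
  rw [intervalIntegral.integral_same, sub_zero] at h'
  refine h'.congr' ?_
  filter_upwards [self_mem_nhdsWithin] with x hx
  have hx : (0 : ℝ) < x := hx
  have := intervalIntegral.integral_Ioi_sub_Ioi hA hx.le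
  have e : ∫ s in (0 : ℝ)..x, (Ioi 0).indicator A s = ∫ s in (0 : ℝ)..x, A s := by
    rw [intervalIntegral.integral_of_le hx.le, intervalIntegral.integral_of_le hx.le]
    exact setIntegral_congr_fun measurableSet_Ioc fun s hs => indicator_of_mem (show s ∈ Ioi 0 from hs.1) _
  rw [e]
  linarith

/-- The convolution is `O(ξ^(1-a+p))`, and `p < a` makes it `o(ξ)`; this removes the boundary term
at infinity. -/
theorem tendsto_truncPowConv_div {a p C : ℝ} (ha1 : a < 1) (hp : 0 ≤ p) (hpa : p < a) {h : ℝ → ℝ}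
    (h0 : ∀ r ≤ 0, h r = 0) (hg : ∀ r > 0, |h r| ≤ C * (1 + r) ^ p) (c : ℝ) :
    Tendsto (fun ξ => truncPowConv a h ξ / (ξ + c)) atTop (𝓝 0) := by
  have hC := nonneg_of_growth hg
  have h1a : 0 < 1 - a := by linarith
  have h1 : Tendsto (fun ξ => truncPowConv a h ξ / ξ) atTop (𝓝 0) := by
    have h2 : Tendsto (fun ξ : ℝ => C / (1 - a) * 2 ^ p * ξ ^ (-(a - p))) atTop (𝓝 0) := by
      simpa using (tendsto_rpow_neg_atTop (sub_pos.2 hpa)).const_mul (C / (1 - a) * 2 ^ p)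
    refine squeeze_zero_norm' ?_ h2
    filter_upwards [eventually_ge_atTop 1] with ξ hξ
    have hξ0 : 0 < ξ := by linarith
    rw [norm_div, Real.norm_eq_abs, Real.norm_of_nonneg hξ0.le, div_le_iff₀ hξ0]
    refine (abs_truncPowConv_le ha1 hp h0 hg hξ0).trans ?_
    have h3 : (1 + ξ) ^ p ≤ 2 ^ p * ξ ^ p := by
      rw [← Real.mul_rpow (by norm_num) hξ0.le]
      exact Real.rpow_le_rpow (by linarith) (by linarith) hp
    have h4 : ξ ^ (-(a - p)) * ξ = ξ ^ p * ξ ^ (1 - a) := by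
      rw [← Real.rpow_add_one hξ0.ne', ← Real.rpow_add hξ0]
      congr 1; ring
    calc C / (1 - a) * (1 + ξ) ^ p * ξ ^ (1 - a) ≤ C / (1 - a) * (2 ^ p * ξ ^ p) * ξ ^ (1 - a) := by
          gcongr
      _ = C / (1 - a) * 2 ^ p * ξ ^ (-(a - p)) * ξ := by rw [mul_assoc _ _ ξ, h4]; ring
  have h2 : Tendsto (fun ξ : ℝ => (1 + c * ξ⁻¹)⁻¹) atTop (𝓝 1) := by
    have := ((tendsto_inv_atTop_zero (𝕜 := ℝ)).const_mul c).const_add 1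
    simpa using this.inv₀ (by simp)
  have h3 := h1.mul h2
  rw [zero_mul] at h3
  refine h3.congr' ?_
  filter_upwards [eventually_gt_atTop 0, eventually_gt_atTop (-c)] with ξ h4 h5
  have : ξ + c ≠ 0 := by linarith
  have e : 1 + c * ξ⁻¹ = (ξ + c) / ξ := by field_simp
  rw [e, inv_div]
  field_simp

theorem truncPowConv_of_nonpos (a : ℝ) {h : ℝ → ℝ} (h0 : ∀ r ≤ 0, h r = 0) {t : ℝ} (ht : t ≤ 0) :
    truncPowConv a h t = 0 := by
  rw [truncPowConv]
  refine integral_eq_zero_of_ae (ae_of_all _ fun u => ?_)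
  rcases le_or_gt u 0 with hu | hu
  · simp [truncPow_of_nonpos a hu]
  · simp [h0 (t - u) (by linarith)]

theorem integrableOn_diff_div_sq {G : ℝ → ℝ} {r : ℝ} (hr : 0 < r) (hG : Continuous G)
    (hG0 : ∀ t ≤ 0, G t = 0) {c : ℝ} (hc : 0 < c) :
    IntegrableOn (fun η => (G (r - η) - G r) / η ^ 2) (Ioi c) := by
  obtain ⟨B, hB⟩ := isCompact_Icc.exists_bound_of_continuousOn (hG.continuousOn (s := Icc 0 r))
  have hB' : ∀ t ≤ r, ‖G t‖ ≤ B := fun t ht => by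
    rcases le_or_gt t 0 with h | h
    · rw [hG0 t h, norm_zero]; exact (norm_nonneg _).trans (hB r ⟨hr.le, le_rfl⟩)
    · exact hB t ⟨h.le, ht⟩
  have hi := (integrableOn_Ioi_rpow_of_lt (a := -2) (by norm_num) hc).const_mul (2 * B)
  refine hi.mono' (Measurable.aestronglyMeasurable (by have := hG.measurable; fun_prop))
    ((ae_restrict_iff' measurableSet_Ioi).2 (ae_of_all _ fun η hη => ?_))
  have hη : 0 < η := hc.trans hη
  rw [norm_div, Real.norm_of_nonneg (sq_nonneg η), Real.rpow_neg hη.le, Real.rpow_two, div_eq_mul_inv]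
  gcongr
  have := norm_sub_le (G (r - η)) (G r)
  linarith [hB' (r - η) (by linarith), hB' r le_rfl]

theorem integral_Ioi_inv_sq {r : ℝ} (hr : 0 < r) (k : ℝ) : ∫ η in Ioi r, k / η ^ 2 = k / r := by
  have h : ∫ η in Ioi r, k / η ^ 2 = ∫ η in Ioi r, k * η ^ (-2 : ℝ) := by
    refine setIntegral_congr_fun measurableSet_Ioi fun η hη => ?_
    have hη : 0 < η := hr.trans hη
    rw [Real.rpow_neg hη.le, Real.rpow_two, div_eq_mul_inv]
  rw [h, integral_const_mul, integral_Ioi_rpow_of_lt (by norm_num) hr]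
  norm_num [Real.rpow_neg_one]
  rfl

/-- Primitive of `G' ξ / (ξ - r)` on `(0, r)` and on `(r, ∞)`. -/
noncomputable def pvPrimitive (G : ℝ → ℝ) (r ξ : ℝ) : ℝ :=
  (G ξ - G r) / (ξ - r) + if ξ < r then ∫ η in Ioi (r - ξ), (G (r - η) - G r) / η ^ 2
    else -∫ η in Ioi (ξ - r), (G (r + η) - G r) / η ^ 2

theorem continuousOn_div_sq {f : ℝ → ℝ} (hf : Continuous f) {c : ℝ} (hc : 0 < c) :
    ContinuousOn (fun η => f η / η ^ 2) (Ioi c) :=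
  hf.continuousOn.div (by fun_prop) fun η hη => by
    have : 0 < η := hc.trans hη
    positivity

section

variable {G : ℝ → ℝ} {r : ℝ}

/-- The forward difference is the second difference minus the backward one, so no separate growth
condition on `G` is needed. -/
theorem integrableOn_forward_div_sq (hr : 0 < r) (hG : Continuous G) (hG0 : ∀ t ≤ 0, G t = 0)
    (hS : IntegrableOn (fun η => (G (r + η) + G (r - η) - 2 * G r) / η ^ 2) (Ioi 0))
    {c : ℝ} (hc : 0 < c) :
    IntegrableOn (fun η => (G (r + η) - G r) / η ^ 2) (Ioi c) := by
  refine ((hS.mono_set (Ioi_subset_Ioi hc.le)).sub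
    (integrableOn_diff_div_sq hr hG hG0 hc)).congr_fun (fun η _ => ?_) measurableSet_Ioi
  simp only [Pi.sub_apply]
  ring

/-- The derivative of the tail integral cancels the term `-(G ξ - G r)/(ξ - r)²` of the quotient
rule. -/
theorem hasDerivAt_pvPrimitive (hr : 0 < r) (hG : Continuous G) (hG0 : ∀ t ≤ 0, G t = 0)
    (hS : IntegrableOn (fun η => (G (r + η) + G (r - η) - 2 * G r) / η ^ 2) (Ioi 0))
    {ξ g : ℝ} (hξ : ξ ≠ r) (hg : HasDerivAt G g ξ) :
    HasDerivAt (pvPrimitive G r) (g / (ξ - r)) ξ := by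
  have hne : ξ - r ≠ 0 := sub_ne_zero.2 hξ
  have hq := (hg.sub_const (G r)).div ((hasDerivAt_id ξ).sub_const r) hne
  rcases lt_or_gt_of_ne hξ with h | h
  · have hc : 0 < r - ξ := by linarith
    have h1 := hasDerivAt_setIntegral_Ioi (half_lt_self hc)
      (integrableOn_diff_div_sq hr hG hG0 (half_pos hc))
      (continuousOn_div_sq (f := fun η => G (r - η) - G r) (by fun_prop) (half_pos hc))
    have h2 := HasDerivAt.comp ξ h1 ((hasDerivAt_id ξ).const_sub r)
    have h3 := hq.add h2
    refine (h3.congr_of_eventuallyEq ?_).congr_deriv ?_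
    · filter_upwards [Iio_mem_nhds h] with x hx
      have hx : x < r := hx
      simp [pvPrimitive, hx]
    · simp only [id, sub_sub_cancel]
      have : r - ξ ≠ 0 := hc.ne'
      have e : (r - ξ) ^ 2 = (ξ - r) ^ 2 := by ring
      rw [e]
      field_simp
      ring
  · have hc : 0 < ξ - r := by linarith
    have h1 := hasDerivAt_setIntegral_Ioi (half_lt_self hc)
      (integrableOn_forward_div_sq hr hG hG0 hS (half_pos hc))
      (continuousOn_div_sq (f := fun η => G (r + η) - G r) (by fun_prop) (half_pos hc))
    have h2 := (HasDerivAt.comp ξ h1 ((hasDerivAt_id ξ).sub_const r)).neg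
    have h3 := hq.add h2
    refine (h3.congr_of_eventuallyEq ?_).congr_deriv ?_
    · filter_upwards [Ioi_mem_nhds h] with x hx
      have hx : ¬ x < r := not_lt.2 (le_of_lt hx)
      simp [pvPrimitive, hx]
    · simp only [id, add_sub_cancel]
      field_simp
      ring

/-- As `G` vanishes on the negative half line, the tail beyond `r` is `-G r / r`, which cancels the
boundary quotient. -/
theorem tendsto_pvPrimitive_zero (hr : 0 < r) (hG : Continuous G) (hG0 : ∀ t ≤ 0, G t = 0) :
    Tendsto (pvPrimitive G r) (𝓝[>] 0) (𝓝 0) := by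
  have h1 := hasDerivAt_setIntegral_Ioi (half_lt_self hr)
      (integrableOn_diff_div_sq hr hG hG0 (half_pos hr))
      (continuousOn_div_sq (f := fun η => G (r - η) - G r) (by fun_prop) (half_pos hr))
  have h2 : ContinuousAt (fun ξ => (G ξ - G r) / (ξ - r) +
      ∫ η in Ioi (r - ξ), (G (r - η) - G r) / η ^ 2) 0 := by
    refine ContinuousAt.add (ContinuousAt.div (by fun_prop) (by fun_prop) (by linarith)) ?_
    refine ContinuousAt.comp (x := (0 : ℝ)) (f := fun ξ => r - ξ)
      (g := fun c => ∫ η in Ioi c, (G (r - η) - G r) / η ^ 2) ?_ (by fun_prop)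
    simpa using h1.continuousAt
  have h3 := h2.tendsto.mono_left (nhdsWithin_le_nhds (s := Ioi 0))
  have e : ∫ η in Ioi r, (G (r - η) - G r) / η ^ 2 = ∫ η in Ioi r, -G r / η ^ 2 := by
    refine setIntegral_congr_fun measurableSet_Ioi fun η hη => ?_
    have hη : r < η := hη
    rw [hG0 _ (by linarith), zero_sub]
  rw [sub_zero, e, integral_Ioi_inv_sq hr, hG0 0 le_rfl] at h3
  have e2 : (0 - G r) / (0 - r) + -G r / r = 0 := by
    rw [zero_sub, zero_sub, neg_div_neg_eq]; ring
  rw [e2] at h3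
  refine h3.congr' ?_
  filter_upwards [Ioo_mem_nhdsGT hr] with ξ hξ
  simp [pvPrimitive, hξ.2]

theorem tendsto_pvPrimitive_atTop (hr : 0 < r) (hG : Continuous G) (hG0 : ∀ t ≤ 0, G t = 0)
    (hS : IntegrableOn (fun η => (G (r + η) + G (r - η) - 2 * G r) / η ^ 2) (Ioi 0))
    (hlim : Tendsto (fun ξ => G ξ / (ξ + -r)) atTop (𝓝 0)) :
    Tendsto (pvPrimitive G r) atTop (𝓝 0) := by
  have h1 := (tendsto_setIntegral_Ioi_atTop
    (integrableOn_forward_div_sq hr hG hG0 hS one_pos)).comp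
    (tendsto_atTop_add_const_right atTop (-r) tendsto_id)
  have h2 : Tendsto (fun ξ : ℝ => G r / (ξ + -r)) atTop (𝓝 0) :=
    tendsto_const_nhds.div_atTop (tendsto_atTop_add_const_right atTop (-r) tendsto_id)
  have h3 := (hlim.sub h2).sub h1
  simp only [sub_zero] at h3
  refine h3.congr' ?_
  filter_upwards [eventually_gt_atTop r] with ξ hξ
  simp only [pvPrimitive, Function.comp, id, if_neg (not_lt.2 hξ.le), ← sub_eq_add_neg, sub_div]

/-- Both difference quotients tend to `G'(r)` and cancel; the two tails add up to the
second-difference integral over `(ε, ∞)`. -/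
theorem tendsto_pvPrimitive_jump (hr : 0 < r) (hG : Continuous G) (hG0 : ∀ t ≤ 0, G t = 0)
    (hS : IntegrableOn (fun η => (G (r + η) + G (r - η) - 2 * G r) / η ^ 2) (Ioi 0))
    {g : ℝ} (hg : HasDerivAt G g r) :
    Tendsto (fun ε => pvPrimitive G r (r - ε) - pvPrimitive G r (r + ε)) (𝓝[>] 0)
      (𝓝 (∫ η in Ioi 0, (G (r + η) + G (r - η) - 2 * G r) / η ^ 2)) := by
  have hs := hg.tendsto_slope
  have c1 : Tendsto (fun ε : ℝ => r - ε) (𝓝[>] 0) (𝓝[≠] r) := by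
    refine tendsto_nhdsWithin_iff.2 ⟨?_, ?_⟩
    · have : Tendsto (fun ε : ℝ => r - ε) (𝓝 0) (𝓝 (r - 0)) := Continuous.tendsto (by fun_prop) 0
      rw [sub_zero] at this
      exact this.mono_left nhdsWithin_le_nhds
    · filter_upwards [self_mem_nhdsWithin] with ε hε
      have hε : 0 < ε := hε
      simp [hε.ne']
  have c2 : Tendsto (fun ε : ℝ => r + ε) (𝓝[>] 0) (𝓝[≠] r) := by
    refine tendsto_nhdsWithin_iff.2 ⟨?_, ?_⟩
    · have : Tendsto (fun ε : ℝ => r + ε) (𝓝 0) (𝓝 (r + 0)) := Continuous.tendsto (by fun_prop) 0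
      rw [add_zero] at this
      exact this.mono_left nhdsWithin_le_nhds
    · filter_upwards [self_mem_nhdsWithin] with ε hε
      have hε : 0 < ε := hε
      simp [hε.ne']
  have h3 := ((hs.comp c1).sub (hs.comp c2)).add (tendsto_setIntegral_Ioi_nhdsGT hS)
  rw [sub_self, zero_add] at h3
  refine h3.congr' ?_
  filter_upwards [self_mem_nhdsWithin] with ε hε
  have hε : 0 < ε := hε
  have e : ∫ η in Ioi ε, (G (r + η) + G (r - η) - 2 * G r) / η ^ 2 =
      (∫ η in Ioi ε, (G (r - η) - G r) / η ^ 2) + ∫ η in Ioi ε, (G (r + η) - G r) / η ^ 2 := by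
    rw [← integral_add (integrableOn_diff_div_sq hr hG hG0 hε)
      (integrableOn_forward_div_sq hr hG hG0 hS hε)]
    congr 1; ext η; ring
  rw [e]
  simp only [pvPrimitive, Function.comp, slope_def_field, if_pos (show r - ε < r by linarith),
    if_neg (show ¬ r + ε < r by linarith), sub_sub_cancel, add_sub_cancel_left]
  ring

end

theorem hasPVIntegral_of_truncPowConv {a p C : ℝ} (ha0 : 0 < a) (ha1 : a < 1) (hp : 0 ≤ p)
    (hpa : p < a) {h h' : ℝ → ℝ} (h0 : ∀ r ≤ 0, h r = 0) (hd : ∀ r > 0, HasDerivAt h (h' r) r)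
    (hc : ContinuousOn h' (Ioi 0)) (hg : ∀ r > 0, |h r| ≤ C * (1 + r) ^ p) {r : ℝ} (hr : 0 < r)
    (κ : ℝ) {F : ℝ → ℝ} (hF : ∀ ξ > 0, ξ ≠ r →
      F ξ = κ * (a * marchaud a h ξ * (1 / (ξ - r) + 1 / (ξ + r)))) :
    HasPVIntegral F r (κ * (a * Real.pi * Real.cot (Real.pi * a) * marchaud a h r +
      a * Real.pi / Real.sin (Real.pi * a) * marchaudRight a h r +
      a * Real.pi / Real.sin (Real.pi * a) * ∫ τ in Ioi 0, h τ * (τ + r) ^ (-1 - a))) := by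
  have hb := bddOnIic_of_growth hp h0 hg
  have hch : ContinuousOn h (Ioi 0) := fun r hr => (hd r hr).continuousAt.continuousWithinAt
  have hm := measurable_of_continuousOn_Ioi_of_eq_zero h0 hch
  have hGc := continuous_truncPowConv ha1 h0 hch hb
  have hG0 : ∀ t ≤ 0, truncPowConv a h t = 0 := fun t ht => truncPowConv_of_nonpos a h0 ht
  have hGd : ∀ t > 0, HasDerivAt (truncPowConv a h) (a * marchaud a h t) t :=
    fun t ht => hasDerivAt_truncPowConv ha0 ha1 h0 hd hc hb ht
  obtain ⟨hS, hSv⟩ := integrableOn_and_integral_second_diff ha0 ha1 hp hpa h0 hd hc hg hr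
  obtain ⟨hT, hTv⟩ := integrableOn_and_integral_truncPowConv_div_sq ha0 ha1 hp hpa h0 hm hg hr
  set G := truncPowConv a h with hGdef
  -- The primitive of `G'(ξ)/(ξ + r)` obtained by parts; it is continuous at `r` and hence
  -- contributes no jump.
  set Φ₂ : ℝ → ℝ := fun ξ => G ξ / (ξ + r) + ∫ s in (0 : ℝ)..ξ, G s / (s + r) ^ 2 with hΦ₂
  have hTc : ContinuousOn (fun s => G s / (s + r) ^ 2) (Ioi (-r)) :=
    hGc.continuousOn.div (by fun_prop) fun s hs => by
      have : 0 < s + r := by have := mem_Ioi.1 hs; linarith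
      positivity
  have hI : ∀ ξ, -r < ξ → HasDerivAt (fun ξ => ∫ s in (0 : ℝ)..ξ, G s / (s + r) ^ 2)
      (G ξ / (ξ + r) ^ 2) ξ := fun ξ hξ => by
    have hsub : uIcc 0 ξ ⊆ Ioi (-r) := fun s hs =>
      lt_of_lt_of_le (lt_min (by linarith) hξ) hs.1
    exact intervalIntegral.integral_hasDerivAt_right (hTc.mono hsub).intervalIntegrable
      (hTc.stronglyMeasurableAtFilter isOpen_Ioi ξ hξ) (hTc.continuousAt (Ioi_mem_nhds hξ))
  have hΦ₂d : ∀ ξ > 0, HasDerivAt Φ₂ (a * marchaud a h ξ / (ξ + r)) ξ := fun ξ hξ => by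
    have hne : ξ + r ≠ 0 := by positivity
    refine (((hGd ξ hξ).div ((hasDerivAt_id ξ).add_const r) hne).add
      (hI ξ (by linarith))).congr_deriv ?_
    simp only [id]
    field_simp
    ring
  have hΦ₂c : ∀ ξ, -r < ξ → ContinuousAt Φ₂ ξ := fun ξ hξ =>
    (hGc.continuousAt.div (by fun_prop) (by linarith)).add (hI ξ hξ).continuousAt
  have hΦ₂0 : Tendsto Φ₂ (𝓝[>] 0) (𝓝 0) := by
    have := (hΦ₂c 0 (by linarith)).tendsto.mono_left (nhdsWithin_le_nhds (s := Ioi 0))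
    simpa [hΦ₂, hG0 0 le_rfl] using this
  have hΦ₂1 : Tendsto Φ₂ atTop (𝓝 (∫ s in Ioi 0, G s / (s + r) ^ 2)) := by
    have := (tendsto_truncPowConv_div ha1 hp hpa h0 hg r).add
      (intervalIntegral_tendsto_integral_Ioi 0 hT tendsto_id)
    rwa [zero_add] at this
  have hΦ₂j : Tendsto (fun ε => Φ₂ (r - ε) - Φ₂ (r + ε)) (𝓝[>] 0) (𝓝 0) := by
    have hcr := hΦ₂c r (by linarith)
    have h1 : ContinuousAt (fun ε => Φ₂ (r - ε) - Φ₂ (r + ε)) 0 :=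
      (ContinuousAt.comp (x := (0 : ℝ)) (g := Φ₂) (f := fun ε => r - ε) (by simpa using hcr) (by fun_prop)).sub
        (ContinuousAt.comp (x := (0 : ℝ)) (g := Φ₂) (f := fun ε => r + ε) (by simpa using hcr) (by fun_prop))
    have := h1.tendsto.mono_left (nhdsWithin_le_nhds (s := Ioi 0))
    simpa using this
  have key := HasPVIntegral.of_primitive (F := F) (Φ := fun ξ => κ * (pvPrimitive G r ξ + Φ₂ ξ)) hr
    (fun ξ hξ hne => by
      refine (((hasDerivAt_pvPrimitive hr hGc hG0 hS hne (hGd ξ hξ)).add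
        (hΦ₂d ξ hξ)).const_mul κ).congr_deriv ?_
      rw [hF ξ hξ hne]; ring)
    (by
      have hmc := continuousOn_marchaud ha0 ha1 h0 hd hc hb
      have : ContinuousOn (fun ξ => κ * (a * marchaud a h ξ * (1 / (ξ - r) + 1 / (ξ + r))))
          (Ioi 0 \ {r}) := by
        refine continuousOn_const.mul ((continuousOn_const.mul (hmc.mono sdiff_subset)).mul
          (ContinuousOn.add (continuousOn_const.div (by fun_prop) fun ξ hξ => sub_ne_zero.2 hξ.2)
            (continuousOn_const.div (by fun_prop) fun ξ hξ => ?_)))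
        have : 0 < ξ := hξ.1
        positivity
      exact this.congr fun ξ hξ => hF ξ hξ.1 hξ.2)
    (((tendsto_pvPrimitive_zero hr hGc hG0).add hΦ₂0).const_mul κ)
    (((tendsto_pvPrimitive_atTop hr hGc hG0 hS
      (tendsto_truncPowConv_div ha1 hp hpa h0 hg (-r))).add hΦ₂1).const_mul κ)
    (d := κ * ((∫ η in Ioi 0, (G (r + η) + G (r - η) - 2 * G r) / η ^ 2) + 0))
    ((((tendsto_pvPrimitive_jump hr hGc hG0 hS (hGd r hr)).add hΦ₂j).const_mul κ).congr
      fun ε => by ring)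
  convert key using 1
  rw [hSv, hTv]
  ring

/-! ### Derivatives on the half line and the Riemann–Liouville derivative -/

theorem contDiffOn_and_iteratedDeriv_of_chain {m : ℕ} {f : ℝ → ℝ} {D : ℕ → ℝ → ℝ}
    (h0 : EqOn f (D 0) (Ioi 0)) (hd : ∀ j < m, ∀ t > 0, HasDerivAt (D j) (D (j + 1) t) t)
    (hc : ContinuousOn (D m) (Ioi 0)) :
    ContDiffOn ℝ m f (Ioi 0) ∧ ∀ j ≤ m, EqOn (iteratedDeriv j f) (D j) (Ioi 0) := by
  have hit : ∀ j ≤ m, EqOn (iteratedDeriv j f) (D j) (Ioi 0) := by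
    intro j
    induction j with
    | zero => intro _; rwa [iteratedDeriv_zero]
    | succ j ih =>
      intro hj t ht
      have e : iteratedDeriv j f =ᶠ[𝓝 t] D j :=
        (ih (by omega)).eventuallyEq_of_mem (Ioi_mem_nhds ht)
      rw [iteratedDeriv_succ, e.deriv_eq, (hd j (by omega) t ht).deriv]
  refine ⟨?_, hit⟩
  have hcD : ∀ j ≤ m, ContinuousOn (D j) (Ioi 0) := fun j hj => by
    rcases hj.lt_or_eq with h | rfl
    · exact fun t ht => (hd j h t ht).continuousAt.continuousWithinAt
    · exact hc
  have hw : ∀ j ≤ m, EqOn (iteratedDerivWithin j f (Ioi 0)) (D j) (Ioi 0) := fun j hj t ht => by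
    rw [iteratedDerivWithin_of_isOpen isOpen_Ioi ht, hit j hj ht]
  rw [contDiffOn_nat_iff_continuousOn_differentiableOn_deriv isOpen_Ioi.uniqueDiffOn]
  refine ⟨fun j hj => (hcD j hj).congr (hw j hj), fun j hj => ?_⟩
  refine DifferentiableOn.congr (fun t ht => ?_) (hw j hj.le)
  exact (hd j hj t ht).differentiableAt.differentiableWithinAt

/-- The `j`-th derivative of `φ` on `(0, ∞)`, extended by zero to `(-∞, 0]`. -/
noncomputable def halfLineDeriv (φ : ℝ → ℝ) (j : ℕ) : ℝ → ℝ := (Ioi 0).indicator (iteratedDeriv j φ)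

section

variable {φ : ℝ → ℝ} {m j : ℕ}

theorem halfLineDeriv_of_nonpos (φ : ℝ → ℝ) (j : ℕ) : ∀ r ≤ 0, halfLineDeriv φ j r = 0 :=
  fun _ hr => indicator_of_notMem (not_lt.2 hr) _

theorem halfLineDeriv_of_pos (φ : ℝ → ℝ) (j : ℕ) {r : ℝ} (hr : 0 < r) :
    halfLineDeriv φ j r = iteratedDeriv j φ r :=
  indicator_of_mem (show r ∈ Ioi 0 from hr) _

theorem hasDerivAt_halfLineDeriv (hreg : ContDiffOn ℝ m φ (Ioi 0)) (hj : j < m) :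
    ∀ r > 0, HasDerivAt (halfLineDeriv φ j) (halfLineDeriv φ (j + 1) r) r := by
  intro r hr
  have h1 := (hreg.differentiableOn_iteratedDerivWithin (by exact_mod_cast hj)
    isOpen_Ioi.uniqueDiffOn).differentiableAt (Ioi_mem_nhds hr)
  have e1 : iteratedDerivWithin j φ (Ioi 0) =ᶠ[𝓝 r] iteratedDeriv j φ :=
    (iteratedDerivWithin_of_isOpen isOpen_Ioi).eventuallyEq_of_mem (Ioi_mem_nhds hr)
  have h2 := (e1.differentiableAt_iff.1 h1).hasDerivAt
  rw [← iteratedDeriv_succ] at h2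
  rw [halfLineDeriv_of_pos φ _ hr]
  refine h2.congr_of_eventuallyEq ?_
  filter_upwards [Ioi_mem_nhds hr] with t ht using halfLineDeriv_of_pos φ j ht

theorem continuousOn_halfLineDeriv (hreg : ContDiffOn ℝ m φ (Ioi 0)) (hj : j ≤ m) :
    ContinuousOn (halfLineDeriv φ j) (Ioi 0) := by
  refine (hreg.continuousOn_iteratedDerivWithin (by exact_mod_cast hj)
    isOpen_Ioi.uniqueDiffOn).congr fun r hr => ?_
  rw [halfLineDeriv_of_pos φ j hr, iteratedDerivWithin_of_isOpen isOpen_Ioi hr]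

theorem tendsto_halfLineDeriv (hinit : Tendsto (iteratedDeriv j φ) (𝓝[>] 0) (𝓝 0)) :
    Tendsto (halfLineDeriv φ j) (𝓝[>] 0) (𝓝 0) := by
  refine hinit.congr' ?_
  filter_upwards [self_mem_nhdsWithin] with r hr using (halfLineDeriv_of_pos φ j hr).symm

theorem bddOnIic_halfLineDeriv (hreg : ContDiffOn ℝ m φ (Ioi 0)) (hj : j ≤ m)
    (hinit : Tendsto (iteratedDeriv j φ) (𝓝[>] 0) (𝓝 0)) : BddOnIic (halfLineDeriv φ j) := by
  intro M
  have h1 : ∀ᶠ r in 𝓝[>] (0 : ℝ), |halfLineDeriv φ j r| ≤ 1 := by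
    have := (tendsto_halfLineDeriv hinit).eventually (Metric.ball_mem_nhds 0 one_pos)
    filter_upwards [this] with r hr
    have : |halfLineDeriv φ j r| < 1 := by simpa using hr
    exact this.le
  obtain ⟨u, hu, hu1⟩ := mem_nhdsGT_iff_exists_Ioo_subset.1 h1
  have hu : 0 < u := hu
  obtain ⟨B, hB⟩ := isCompact_Icc.exists_bound_of_continuousOn
    ((continuousOn_halfLineDeriv hreg hj).mono fun r (hr : r ∈ Icc u M) => hu.trans_le hr.1)
  refine ⟨max 1 B, fun r hr => ?_⟩
  rcases le_or_gt r 0 with h2 | h2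
  · rw [halfLineDeriv_of_nonpos φ j r h2, abs_zero]; positivity
  rcases lt_or_ge r u with h3 | h3
  · exact (hu1 ⟨h2, h3⟩).trans (le_max_left _ _)
  · exact (hB r ⟨h3, hr⟩).trans (le_max_right _ _)

/-- Decay against `r^(-b)` controls large `r` and local boundedness the rest; truncating the
exponent at `0` keeps the bound monotone in `r`. -/
theorem growth_halfLineDeriv (hreg : ContDiffOn ℝ m φ (Ioi 0)) (hj : j ≤ m)
    (hinit : Tendsto (iteratedDeriv j φ) (𝓝[>] 0) (𝓝 0)) {b : ℝ}
    (hinf : Tendsto (fun r : ℝ => iteratedDeriv j φ r * r ^ (-b)) atTop (𝓝 0)) :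
    ∃ C, ∀ r > 0, |halfLineDeriv φ j r| ≤ C * (1 + r) ^ max b 0 := by
  have h1 : ∀ᶠ r in atTop, |iteratedDeriv j φ r * r ^ (-b)| ≤ 1 := by
    have := hinf.eventually (Metric.ball_mem_nhds 0 one_pos)
    filter_upwards [this] with r hr
    have : |iteratedDeriv j φ r * r ^ (-b)| < 1 := by simpa using hr
    exact this.le
  obtain ⟨R, hR⟩ := eventually_atTop.1 h1
  obtain ⟨B, hB⟩ := bddOnIic_halfLineDeriv hreg hj hinit (max R 1)
  refine ⟨max 1 B, fun r hr => ?_⟩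
  rcases le_or_gt r (max R 1) with h2 | h2
  · calc |halfLineDeriv φ j r| ≤ max 1 B := (hB r h2).trans (le_max_right _ _)
      _ ≤ _ := le_mul_of_one_le_right (by positivity)
        (Real.one_le_rpow (by linarith) (le_max_right _ _))
  · have h3 := hR r ((le_max_left _ _).trans h2.le)
    have hr1 : 1 ≤ r := (le_max_right _ _).trans h2.le
    have h4 : 0 < r ^ b := Real.rpow_pos_of_pos hr _
    have h5 : |iteratedDeriv j φ r| ≤ r ^ b := by
      have e : r ^ (-b) * r ^ b = 1 := by rw [← Real.rpow_add hr]; simp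
      have h6 : 0 < r ^ (-b) := Real.rpow_pos_of_pos hr _
      rw [abs_mul, abs_of_pos h6] at h3
      nlinarith [abs_nonneg (iteratedDeriv j φ r)]
    rw [halfLineDeriv_of_pos φ j hr]
    calc |iteratedDeriv j φ r| ≤ r ^ b := h5
      _ ≤ r ^ max b 0 := Real.rpow_le_rpow_of_exponent_le hr1 (le_max_left _ _)
      _ ≤ (1 + r) ^ max b 0 := Real.rpow_le_rpow hr.le (by linarith) (le_max_right _ _)
      _ ≤ _ := le_mul_of_one_le_left (by positivity) (le_max_left _ _)

theorem rlIntegral_eq_truncPowConv (a : ℝ) (φ : ℝ → ℝ) {t : ℝ} (ht : 0 < t) :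
    rlIntegral (1 - a) φ t = 1 / Real.Gamma (1 - a) * truncPowConv a (halfLineDeriv φ 0) t := by
  rw [rlIntegral, truncPowConv_eq_integral_Ioi a (halfLineDeriv_of_nonpos φ 0),
    intervalIntegral.integral_of_le ht.le, integral_Ioc_eq_integral_Ioo]
  congr 1
  have e : ∀ τ ∈ Ioi (0 : ℝ), halfLineDeriv φ 0 τ * truncPow a (t - τ) =
      (Iio t).indicator (fun τ => (t - τ) ^ (1 - a - 1) * φ τ) τ := fun τ hτ => by
    rw [halfLineDeriv_of_pos φ 0 hτ, iteratedDeriv_zero]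
    by_cases h : τ < t
    · rw [indicator_of_mem (show τ ∈ Iio t from h), truncPow_of_pos _ (by linarith), mul_comm]
      congr 2; ring
    · rw [indicator_of_notMem (show τ ∉ Iio t from h), truncPow_of_nonpos _ (by linarith), mul_zero]
  rw [setIntegral_congr_fun measurableSet_Ioi e, setIntegral_indicator measurableSet_Iio,
    Ioi_inter_Iio]

theorem contDiffOn_rlIntegral_and_rlDeriv {n : ℕ} {a : ℝ} (ha0 : 0 < a) (ha1 : a < 1)
    (hreg : ContDiffOn ℝ (n + 1 : ℕ) φ (Ioi 0))
    (hinit : ∀ j < n + 1, Tendsto (iteratedDeriv j φ) (𝓝[>] 0) (𝓝 0)) :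
    ContDiffOn ℝ (n + 1 : ℕ) (rlIntegral (1 - a) φ) (Ioi 0) ∧
    ∀ t > 0, iteratedDeriv (n + 1) (rlIntegral (1 - a) φ) t =
      1 / Real.Gamma (1 - a) * (a * marchaud a (halfLineDeriv φ n) t) := by
  -- The first `n` derivatives fall on `φ`; the last one is taken in Marchaud form.
  set D : ℕ → ℝ → ℝ := fun j t => 1 / Real.Gamma (1 - a) *
    if j ≤ n then truncPowConv a (halfLineDeriv φ j) t
    else a * marchaud a (halfLineDeriv φ n) t with hD
  have hbd : ∀ j ≤ n, BddOnIic (halfLineDeriv φ j) := fun j hj =>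
    bddOnIic_halfLineDeriv hreg (by omega) (hinit j (by omega))
  have h := contDiffOn_and_iteratedDeriv_of_chain (m := n + 1) (f := rlIntegral (1 - a) φ) (D := D)
    (fun t ht => by
      simp only [hD, Nat.zero_le, if_true]
      exact rlIntegral_eq_truncPowConv a φ ht)
    (fun j hj t ht => by
      have hjn : j ≤ n := by omega
      simp only [hD, hjn, if_true]
      refine HasDerivAt.const_mul _ ?_
      rcases hjn.lt_or_eq with h1 | rfl
      · rw [if_pos (by omega)]
        exact hasDerivAt_truncPowConv_of_tendsto_zero ha1 (halfLineDeriv_of_nonpos φ j)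
          (halfLineDeriv_of_nonpos φ (j + 1)) (hasDerivAt_halfLineDeriv hreg hj)
          (continuousOn_halfLineDeriv hreg (by omega)) (tendsto_halfLineDeriv (hinit j hj))
          (hbd j hjn) (hbd (j + 1) (by omega)) ht
      · rw [if_neg (by omega)]
        exact hasDerivAt_truncPowConv ha0 ha1 (halfLineDeriv_of_nonpos φ j)
          (hasDerivAt_halfLineDeriv hreg hj) (continuousOn_halfLineDeriv hreg (by omega))
          (hbd j hjn) ht)
    (by
      have hn : ¬ n + 1 ≤ n := by omega
      simp only [hD, hn, if_false]
      exact continuousOn_const.mul (continuousOn_const.mul (continuousOn_marchaud ha0 ha1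
        (halfLineDeriv_of_nonpos φ n) (hasDerivAt_halfLineDeriv hreg (by omega))
        (continuousOn_halfLineDeriv hreg (by omega)) (hbd n le_rfl))))
  refine ⟨h.1, fun t ht => ?_⟩
  rw [h.2 (n + 1) le_rfl ht]
  simp [hD]

end

/-! ### The Riesz integral of an even function -/

theorem iteratedDeriv_two_mul_even {φ : ℝ → ℝ} (heven : ∀ x, φ x = φ |x|) (l : ℕ) (x : ℝ) :
    iteratedDeriv (2 * l) φ (-x) = iteratedDeriv (2 * l) φ x := by
  have e : (fun x => φ (-x)) = φ := by
    ext x; rw [heven (-x), abs_neg, ← heven]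
  have h := iteratedDeriv_comp_neg (2 * l) φ x
  rw [e] at h
  rw [h]
  simp [pow_mul]

theorem rieszInner_neg {φ : ℝ → ℝ} (heven : ∀ x, φ x = φ |x|) (α x : ℝ) :
    rieszInner α φ (-x) = rieszInner α φ x := by
  rw [rieszInner, rieszInner, iteratedDeriv_two_mul_even heven]

theorem rieszIntegrand_abs {f : ℝ → ℝ} (hf : ∀ x, f (-x) = f x) (β x : ℝ) :
    rieszIntegrand β f |x| = rieszIntegrand β f x := by
  rcases abs_choice x with h | h
  · rw [h]
  · rw [h]
    ext z
    have e1 : f (-x + z) = f (x - z) := by rw [← hf (x - z)]; congr 1; ring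
    have e2 : f (-x - z) = f (x + z) := by rw [← hf (x + z)]; congr 1; ring
    rw [rieszIntegrand, rieszIntegrand, e1, e2, hf]
    ring

theorem integrableOn_and_integral_reflected {a : ℝ} {h : ℝ → ℝ} (h0 : ∀ r ≤ 0, h r = 0) {r : ℝ}
    (hr : 0 < r) (hi : IntegrableOn (fun τ => h τ * (τ + r) ^ (-1 - a)) (Ioi 0)) :
    IntegrableOn (fun z => h (z - r) * z ^ (-1 - a)) (Ioi 0) ∧
    ∫ z in Ioi 0, h (z - r) * z ^ (-1 - a) = ∫ τ in Ioi 0, h τ * (τ + r) ^ (-1 - a) := by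
  have e : (Ioi 0).indicator (fun z => h (z - r) * z ^ (-1 - a)) =
      fun z => (Ioi 0).indicator (fun τ => h τ * (τ + r) ^ (-1 - a)) (z - r) := by
    ext z
    by_cases hz : 0 < z - r
    · rw [indicator_of_mem (show z ∈ Ioi 0 from mem_Ioi.2 (by linarith)),
        indicator_of_mem (show z - r ∈ Ioi 0 from hz), sub_add_cancel]
    · rw [indicator_of_notMem (show z - r ∉ Ioi 0 from hz)]
      refine indicator_apply_eq_zero.2 fun _ => ?_
      rw [h0 _ (not_lt.1 hz), zero_mul]
  rw [← integrable_indicator_iff measurableSet_Ioi, ← integral_indicator measurableSet_Ioi, e,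
    integral_sub_right_eq_self ((Ioi 0).indicator (fun τ => h τ * (τ + r) ^ (-1 - a))) r,
    integral_indicator measurableSet_Ioi]
  exact ⟨(hi.integrable_indicator measurableSet_Ioi).comp_sub_right r, rfl⟩

/-- Evenness gives `f (r - z) = ε (h (r - z) + h (z - r))`, one of the two terms being zero. The
second difference splits into a forward, a backward and a reflected part, each integrable because `a
< 1`. -/
theorem rieszIntegrand_of_order_lt_one {a p C r : ℝ} {h h' f : ℝ → ℝ} {ε : ℝ} (ha0 : 0 < a)
    (ha1 : a < 1) (hp : 0 ≤ p) (hpa : p < a) (h0 : ∀ r ≤ 0, h r = 0)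
    (hd : ∀ r > 0, HasDerivAt h (h' r) r) (hc : ContinuousOn h' (Ioi 0))
    (hg : ∀ r > 0, |h r| ≤ C * (1 + r) ^ p) (hr : 0 < r) (hf : ∀ x, f (-x) = f x)
    (hfh : ∀ x > 0, f x = ε * h x) :
    IntegrableOn (rieszIntegrand a f r) (Ioi 0) ∧
    ∫ z in Ioi 0, rieszIntegrand a f r z = ε * (marchaudRight a h r - marchaud a h r +
      ∫ τ in Ioi 0, h τ * (τ + r) ^ (-1 - a)) := by
  have hb := bddOnIic_of_growth hp h0 hg
  have hch : ContinuousOn h (Ioi 0) := fun r hr => (hd r hr).continuousAt.continuousWithinAt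
  have hm := measurable_of_continuousOn_Ioi_of_eq_zero h0 hch
  have i1 := integrableOn_forward_diff ha1 hp hpa hm hd hc hg hr
  have i2 := integrableOn_marchaud ha0 ha1 hm hd hc hb hr
  obtain ⟨i3, v3⟩ := integrableOn_and_integral_reflected h0 hr
    (integrableOn_mul_add_rpow ha0 ha1 hp hpa hm hg hr)
  have i12 : IntegrableOn (fun z => (h (r + z) - h r) * z ^ (-1 - a) -
    (h r - h (r - z)) * z ^ (-1 - a)) (Ioi 0) := i1.sub i2
  have i123 : IntegrableOn (fun z => (h (r + z) - h r) * z ^ (-1 - a) -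
    (h r - h (r - z)) * z ^ (-1 - a) + h (z - r) * z ^ (-1 - a)) (Ioi 0) := i12.add i3
  have hae : ∀ᵐ z ∂(volume.restrict (Ioi (0 : ℝ))),
      ε * ((h (r + z) - h r) * z ^ (-1 - a) - (h r - h (r - z)) * z ^ (-1 - a) +
        h (z - r) * z ^ (-1 - a)) = rieszIntegrand a f r z := by
    -- At `z = r` the value `f 0` appears, about which nothing is known.
    have hne : ∀ᵐ z : ℝ, z ≠ r := by simp [ae_iff, measure_singleton]
    refine (ae_restrict_iff' measurableSet_Ioi).2 (hne.mono fun z hz hz0 => ?_)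
    have hz0 : 0 < z := hz0
    have e1 : f (r - z) = ε * (h (r - z) + h (z - r)) := by
      rcases lt_or_gt_of_ne hz with h1 | h1
      · rw [hfh _ (by linarith), h0 (z - r) (by linarith), add_zero]
      · rw [← hf, neg_sub, hfh _ (by linarith), h0 (r - z) (by linarith), zero_add]
    have e2 : z ^ (-1 - a) = (z ^ (1 + a))⁻¹ := by
      rw [← Real.rpow_neg hz0.le]; congr 1; ring
    rw [rieszIntegrand, e1, hfh _ (by linarith), hfh r hr, e2]
    ring
  refine ⟨(i123.const_mul ε).congr hae, ?_⟩
  rw [← integral_congr_ae hae, integral_const_mul, integral_add i12 i3, integral_sub i1 i2, v3]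
  rfl

/-- Off `z = r` the second difference of `f` is `ε` times the integral over `(0, z)` of `h (r + w) -
h (r - w) + h (w - r)`. The Hardy identity with `b = 1 + a` lowers the order by one and yields the
factor `1/(1 + a)`; evenness changes the sign of the backward part compared with order `a`. -/
theorem rieszIntegrand_of_one_lt_order {a p C r : ℝ} {q h h' f : ℝ → ℝ} {ε : ℝ} (ha0 : 0 < a)
    (ha1 : a < 1) (hp : 0 ≤ p) (hpa : p < a) (h0 : ∀ r ≤ 0, h r = 0)
    (hd : ∀ r > 0, HasDerivAt h (h' r) r) (hc : ContinuousOn h' (Ioi 0))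
    (hg : ∀ r > 0, |h r| ≤ C * (1 + r) ^ p) (hr : 0 < r) (hq0 : ∀ r ≤ 0, q r = 0)
    (hq : ∀ x y, q y - q x = ∫ s in x..y, h s) (hf : ∀ x, f (-x) = f x)
    (hfq : ∀ x > 0, f x = ε * q x) :
    IntegrableOn (rieszIntegrand (1 + a) f r) (Ioi 0) ∧
    ∫ z in Ioi 0, rieszIntegrand (1 + a) f r z = ε / (1 + a) * (marchaudRight a h r +
      marchaud a h r + ∫ τ in Ioi 0, h τ * (τ + r) ^ (-1 - a)) := by
  have hb := bddOnIic_of_growth hp h0 hg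
  have hch : ContinuousOn h (Ioi 0) := fun r hr => (hd r hr).continuousAt.continuousWithinAt
  have hm := measurable_of_continuousOn_Ioi_of_eq_zero h0 hch
  have i1 := integrableOn_forward_diff ha1 hp hpa hm hd hc hg hr
  have i2 := integrableOn_marchaud ha0 ha1 hm hd hc hb hr
  obtain ⟨i3, v3⟩ := integrableOn_and_integral_reflected h0 hr
    (integrableOn_mul_add_rpow ha0 ha1 hp hpa hm hg hr)
  have i12 : IntegrableOn (fun z => (h (r + z) - h r) * z ^ (-1 - a) +
    (h r - h (r - z)) * z ^ (-1 - a)) (Ioi 0) := i1.add i2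
  have i123 : IntegrableOn (fun z => (h (r + z) - h r) * z ^ (-1 - a) +
    (h r - h (r - z)) * z ^ (-1 - a) + h (z - r) * z ^ (-1 - a)) (Ioi 0) := i12.add i3
  have ek : EqOn (fun z => (h (r + z) - h r) * z ^ (-1 - a) +
      (h r - h (r - z)) * z ^ (-1 - a) + h (z - r) * z ^ (-1 - a))
      (fun w => (h (r + w) - h (r - w) + h (w - r)) * w ^ (-(1 + a))) (Ioi 0) := fun z _ => by
    simp only
    rw [show -(1 + a) = -1 - a by ring]
    ring
  obtain ⟨hi, hv⟩ := hardy_integrableOn_and_integral (b := 1 + a) (by linarith)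
    (k := fun w => h (r + w) - h (r - w) + h (w - r)) (by fun_prop)
    (i123.congr_fun ek measurableSet_Ioi)
  have hii := hb.intervalIntegrable hm
  have hE : ∀ z, ∫ w in (0 : ℝ)..z, (h (r + w) - h (r - w) + h (w - r)) =
      q (r + z) - 2 * q r + q (r - z) + q (z - r) := fun z => by
    have j1 : IntervalIntegrable (fun w => h (r + w)) volume 0 z := by
      simpa using (hii (r + 0) (r + z)).comp_add_left r
    have j2 : IntervalIntegrable (fun w => h (r - w)) volume 0 z := by
      simpa using (hii (r - 0) (r - z)).comp_sub_left r
    have j3 : IntervalIntegrable (fun w => h (w - r)) volume 0 z := by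
      simpa using (hii (0 - r) (z - r)).comp_sub_right r
    rw [intervalIntegral.integral_add (j1.sub j2) j3, intervalIntegral.integral_sub j1 j2,
      intervalIntegral.integral_comp_add_left, intervalIntegral.integral_comp_sub_left,
      intervalIntegral.integral_comp_sub_right, ← hq, ← hq, ← hq, hq0 (0 - r) (by linarith)]
    simp only [add_zero, sub_zero]
    ring
  have hae : ∀ᵐ z ∂(volume.restrict (Ioi (0 : ℝ))),
      ε * ((∫ w in (0 : ℝ)..z, (h (r + w) - h (r - w) + h (w - r))) * z ^ (-1 - (1 + a))) =
        rieszIntegrand (1 + a) f r z := by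
    have hne : ∀ᵐ z : ℝ, z ≠ r := by simp [ae_iff, measure_singleton]
    refine (ae_restrict_iff' measurableSet_Ioi).2 (hne.mono fun z hz hz0 => ?_)
    have hz0 : 0 < z := hz0
    have e1 : f (r - z) = ε * (q (r - z) + q (z - r)) := by
      rcases lt_or_gt_of_ne hz with h1 | h1
      · rw [hfq _ (by linarith), hq0 (z - r) (by linarith), add_zero]
      · rw [← hf, neg_sub, hfq _ (by linarith), hq0 (r - z) (by linarith), zero_add]
    have e2 : z ^ (-1 - (1 + a)) = (z ^ (1 + (1 + a)))⁻¹ := by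
      rw [← Real.rpow_neg hz0.le]; congr 1; ring
    rw [hE, rieszIntegrand, e1, hfq _ (by linarith), hfq r hr, e2]
    ring
  refine ⟨(hi.const_mul ε).congr hae, ?_⟩
  rw [← integral_congr_ae hae, integral_const_mul, hv, ← setIntegral_congr_fun measurableSet_Ioi ek,
    integral_add i12 i3, integral_add i1 i2, v3, marchaudRight, marchaud]
  ring

/-! ### Matching the constants and conclusion -/

theorem rieszShift_eq {α : ℝ} {l : ℕ} (h1 : 2 * l ≤ α) (h2 : α < 2 * l + 2) : rieszShift α = l := by
  rw [rieszShift, Nat.floor_eq_iff (by have : (0 : ℝ) ≤ l := Nat.cast_nonneg l; linarith)]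
  constructor <;> linarith

theorem Gamma_one_add_div_pi {a : ℝ} (ha0 : 0 < a) (ha1 : a < 1) :
    Real.Gamma (1 + a) / Real.pi =
      1 / Real.Gamma (1 - a) * a / Real.sin (Real.pi * a) := by
  have h := Real.Gamma_mul_Gamma_one_sub a
  have hs : 0 < Real.sin (Real.pi * a) :=
    Real.sin_pos_of_pos_of_lt_pi (by positivity) (by nlinarith [Real.pi_pos])
  have hΓ : 0 < Real.Gamma (1 - a) := Real.Gamma_pos_of_pos (by linarith)
  rw [add_comm, Real.Gamma_add_one ha0.ne']
  rw [eq_div_iff hs.ne'] at h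
  have e : 1 / Real.Gamma (1 - a) * Real.Gamma (1 - a) = 1 := one_div_mul_cancel hΓ.ne'
  rw [div_eq_div_iff Real.pi_ne_zero hs.ne']
  linear_combination (-(a * Real.Gamma a * Real.sin (Real.pi * a))) * e +
    1 / Real.Gamma (1 - a) * a * h

theorem kernelDiracPart_eq (α : ℝ) (g : ℝ → ℝ) (r : ℝ) :
    kernelDiracPart α g r = -Real.cos (Real.pi * α / 2) * g r := by
  simp [kernelDiracPart]

/-- With `x = πa` this matches the coefficients of the left Marchaud integral for even `n`; the next
identity does so for odd `n`. -/
theorem sin_half_mul_cot_sub_cos_half {x : ℝ} (hs : Real.sin x ≠ 0) :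
    Real.sin (x / 2) * Real.cot x - Real.cos (x / 2) = -(Real.sin (x / 2) / Real.sin x) := by
  rw [Real.cot_eq_cos_div_sin]
  field_simp
  have : Real.sin (x / 2 - x) = -Real.sin (x / 2) := by rw [← Real.sin_neg]; congr 1; ring
  rw [Real.sin_sub] at this
  linarith

theorem cos_half_mul_cot_add_sin_half {x : ℝ} (hs : Real.sin x ≠ 0) :
    Real.cos (x / 2) * Real.cot x + Real.sin (x / 2) = Real.cos (x / 2) / Real.sin x := by
  rw [Real.cot_eq_cos_div_sin]
  field_simp
  have : Real.cos (x - x / 2) = Real.cos (x / 2) := by congr 1; ring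
  rw [Real.cos_sub] at this
  linarith

theorem mainTheorem4 (m : ℕ) (hm : 1 ≤ m) (α : ℝ) (hα1 : (m : ℝ) - 1 < α) (hα2 : α < m)
    (φ : ℝ → ℝ) (heven : ∀ x, φ x = φ |x|)
    (hreg : ContDiffOn ℝ m φ (Ioi 0))
    (σ : ℝ) (hσ0 : 0 < σ) (hσ1 : σ < 1)
    (hzero : ∀ j < m,
      Tendsto (fun r : ℝ => iteratedDeriv j φ r * r ^ (σ - α + j)) (𝓝[>] 0) (𝓝 0))
    (hinfty : ∀ j < m,
      Tendsto (fun r : ℝ => iteratedDeriv j φ r * r ^ (σ - α + j)) atTop (𝓝 0))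
    (hinit : ∀ j < m, Tendsto (iteratedDeriv j φ) (𝓝[>] 0) (𝓝 0)) :
    ContDiffOn ℝ m (rlIntegral ((m : ℝ) - α) φ) (Ioi 0) ∧
    ∀ x : ℝ, x ≠ 0 →
      RieszConvergent α φ x ∧
      HasMellinConvolution α (rlDeriv m α φ) |x| (rieszDeriv α φ x) := by
  obtain ⟨n, rfl⟩ : ∃ n, m = n + 1 := ⟨m - 1, by omega⟩
  obtain ⟨a, rfl⟩ : ∃ a, α = n + a := ⟨α - n, by ring⟩
  have hn0 : (0 : ℝ) ≤ n := Nat.cast_nonneg n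
  push_cast at hα1 hα2
  have ha0 : 0 < a := by linarith
  have ha1 : a < 1 := by linarith
  have hma : ((n + 1 : ℕ) : ℝ) - (n + a) = 1 - a := by push_cast; ring
  obtain ⟨hRL, hRLv⟩ := contDiffOn_rlIntegral_and_rlDeriv ha0 ha1 hreg hinit
  rw [hma]
  refine ⟨hRL, fun x hx => ?_⟩
  have hr : 0 < |x| := abs_pos.2 hx
  set r := |x| with hrdef
  set h := halfLineDeriv φ n with hh
  -- The decay of the `n`-th derivative at infinity gives growth exponent `a - σ`; `σ > 0` keeps it
  -- below `a`.
  have hp : 0 ≤ max (a - σ) 0 := le_max_right _ _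
  have hpa : max (a - σ) 0 < a := max_lt (by linarith) ha0
  have h0 : ∀ r ≤ 0, h r = 0 := halfLineDeriv_of_nonpos φ n
  have hd : ∀ r > 0, HasDerivAt h (halfLineDeriv φ (n + 1) r) r :=
    hasDerivAt_halfLineDeriv hreg (by omega)
  have hc := continuousOn_halfLineDeriv hreg (le_refl (n + 1))
  obtain ⟨C, hg⟩ := growth_halfLineDeriv hreg (by omega) (hinit n (by omega)) (b := a - σ) (by
    have := hinfty n (by omega)
    rwa [show σ - (n + a) + n = -(a - σ) by ring] at this)
  have hgd : ∀ ξ > 0, rlDeriv (n + 1) (n + a) φ ξ =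
      1 / Real.Gamma (1 - a) * (a * marchaud a h ξ) := fun ξ hξ => by
    rw [rlDeriv, hma, hRLv ξ hξ]
  have hS : 0 < Real.sin (Real.pi * a) :=
    Real.sin_pos_of_pos_of_lt_pi (by positivity) (by nlinarith [Real.pi_pos])
  have hΓ := Gamma_one_add_div_pi ha0 ha1
  set c := 1 / Real.Gamma (1 - a) with hcdef
  set s := Real.sin (Real.pi * (n + a) / 2) with hs
  -- In the factor `c * s / π` the `2` of `2/π` is absorbed by `ξ/(ξ² - r²) = (1/2)(1/(ξ - r) + 1/(ξ
  -- + r))`.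
  have hPV := hasPVIntegral_of_truncPowConv ha0 ha1 hp hpa h0 hd hc hg hr (c * s / Real.pi)
    (F := fun ξ => rlDeriv (n + 1) (n + a) φ ξ * kernelRegular (n + a) (r / ξ) / ξ)
    (fun ξ hξ hne => by
      rw [hgd ξ hξ, kernelRegular, ← hs]
      have h1 : ξ - r ≠ 0 := sub_ne_zero.2 hne
      have h2 : ξ + r ≠ 0 := by positivity
      have h3 : 1 - (r / ξ) ^ 2 = (ξ - r) * (ξ + r) / ξ ^ 2 := by field_simp; ring
      rw [h3]
      have hpi := Real.pi_pos
      field_simp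
      ring)
  set K := ∫ τ in Ioi 0, h τ * (τ + r) ^ (-1 - a) with hK
  have hfe : ∀ y, rieszInner (n + a) φ (-y) = rieszInner (n + a) φ y := rieszInner_neg heven (n + a)
  have hpi : Real.pi / Real.pi = 1 := div_self Real.pi_ne_zero
  -- For `n = 2l` the order left after `2l` derivatives is `a`, for `n = 2l + 1` it is `1 + a`.
  rcases Nat.even_or_odd' n with ⟨l, hl | hl⟩
  · have hnl : (n : ℝ) = 2 * l := by rw [hl]; push_cast; ring
    have hshift : rieszShift (n + a) = l := rieszShift_eq (by linarith) (by linarith)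
    have hβ : (n : ℝ) + a - 2 * rieszShift (n + a) = a := by rw [hshift, hnl]; ring
    obtain ⟨hI, hIv⟩ := rieszIntegrand_of_order_lt_one (ε := (-1) ^ l) ha0 ha1 hp hpa h0 hd hc hg hr
      hfe (fun y hy => by
        rw [rieszInner, hshift, hh, halfLineDeriv_of_pos φ n hy, hl])
    rw [hrdef, rieszIntegrand_abs hfe] at hI hIv
    refine ⟨by rwa [RieszConvergent, hβ], _, hPV, ?_⟩
    have hs' : s = (-1) ^ l * Real.sin (Real.pi * a / 2) := by
      rw [hs, ← Real.sin_add_nat_mul_pi, hnl]; congr 1; ring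
    have hc' : Real.cos (Real.pi * (n + a) / 2) = (-1) ^ l * Real.cos (Real.pi * a / 2) := by
      rw [← Real.cos_add_nat_mul_pi, hnl]; congr 1; ring
    rw [kernelDiracPart_eq, hgd r hr, rieszDeriv, hβ, rieszDerivBase, hIv, hΓ, hs', hc']
    have key := sin_half_mul_cot_sub_cos_half hS.ne'
    linear_combination (-(c * a * (-1) ^ l * marchaud a h r)) * key -
      c * ((-1) ^ l * Real.sin (Real.pi * a / 2)) * (a * Real.cot (Real.pi * a) * marchaud a h r +
        a / Real.sin (Real.pi * a) * (marchaudRight a h r + K)) * hpi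
  · have hnl : (n : ℝ) = 2 * l + 1 := by rw [hl]; push_cast; ring
    have hshift : rieszShift (n + a) = l := rieszShift_eq (by linarith) (by linarith)
    have hβ : (n : ℝ) + a - 2 * rieszShift (n + a) = 1 + a := by rw [hshift, hnl]; ring
    have hh' : h = halfLineDeriv φ (2 * l + 1) := by rw [hh, hl]
    -- Here the Riesz integrand involves the derivative of order `2l = n - 1`, whose extension by
    -- zero is a primitive of `h`.
    have hq := sub_eq_integral_of_tendsto_zero (halfLineDeriv_of_nonpos φ (2 * l))
      (halfLineDeriv_of_nonpos φ (2 * l + 1)) (hasDerivAt_halfLineDeriv hreg (by omega))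
      (continuousOn_halfLineDeriv hreg (by omega)) (tendsto_halfLineDeriv (hinit (2 * l) (by omega)))
      (bddOnIic_halfLineDeriv hreg (by omega) (hinit (2 * l + 1) (by omega)))
    rw [← hh'] at hq
    obtain ⟨hI, hIv⟩ := rieszIntegrand_of_one_lt_order (ε := (-1) ^ l) ha0 ha1 hp hpa h0 hd hc hg hr
      (halfLineDeriv_of_nonpos φ (2 * l)) hq hfe (fun y hy => by
        rw [rieszInner, hshift, halfLineDeriv_of_pos φ _ hy])
    rw [hrdef, rieszIntegrand_abs hfe] at hI hIv
    refine ⟨by rwa [RieszConvergent, hβ], _, hPV, ?_⟩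
    have hs' : s = (-1) ^ l * Real.cos (Real.pi * a / 2) := by
      rw [hs, ← Real.sin_add_pi_div_two, ← Real.sin_add_nat_mul_pi, hnl]; congr 1; ring
    have hc' : Real.cos (Real.pi * (n + a) / 2) = -((-1) ^ l * Real.sin (Real.pi * a / 2)) := by
      rw [← mul_neg, ← Real.cos_add_pi_div_two, ← Real.cos_add_nat_mul_pi, hnl]; congr 1; ring
    have hΓ2 : Real.Gamma (1 + (1 + a)) / Real.pi = (1 + a) * (c * a / Real.sin (Real.pi * a)) := by
      rw [← hΓ, add_comm 1 (1 + a), Real.Gamma_add_one (by positivity)]; ring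
    have hsin : Real.sin (Real.pi * (1 + a) / 2) = Real.cos (Real.pi * a / 2) := by
      rw [← Real.sin_add_pi_div_two]; congr 1; ring
    rw [kernelDiracPart_eq, hgd r hr, rieszDeriv, hβ, rieszDerivBase, hIv, hΓ2, hs', hc', hsin]
    have key := cos_half_mul_cot_add_sin_half hS.ne'
    have h1a : (1 + a) / (1 + a) = 1 := div_self (by positivity)
    linear_combination (-(c * a * (-1) ^ l * marchaud a h r)) * key -
      c * ((-1) ^ l * Real.cos (Real.pi * a / 2)) * (a * Real.cot (Real.pi * a) * marchaud a h r +
        a / Real.sin (Real.pi * a) * (marchaudRight a h r + K)) * hpi +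
      c * a / Real.sin (Real.pi * a) * Real.cos (Real.pi * a / 2) * (-1) ^ l *
        (marchaudRight a h r + marchaud a h r + K) * h1a
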